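/- **Setting.** Let $P=(v_0,\dots,v_m)$ be a path, drawn from left to right, with edges $e_i=(v_i,v_{i+1})$, and let $G$ be an embedded graph that consists of $P$ and of terminals (nodes of degree one) attached to the nodes of $P$; the clockwise order of the terminals around every $v_i$, above and below $P$, is given. Let $L$ be a finite set of lines, that is, simple paths between two terminals, where no two lines end at the same terminal. A line *starts* (*ends*) at its leftmost (rightmost) node on $P$; lines that use no edge of $P$ play no role. Let $L_e$ be the set of lines through the edge $e$. A *block move* exchanges two consecutive nonempty blocks of a sequence. A *feasible solution* of block crossing minimization (BCM) gives for every edge $e$ of $P$ orders $\pi^0(e),\dots,\pi^{t(e)}(e)$ of $L_e$ (top to bottom, $\pi^0(e)$ near the left node, $\pi^{t(e)}(e)$ near the right node), each obtained from the preceding one by a block move, that are consistent: near each end node of $e$, the order of $L_e$ agrees with the combined clockwise order of $L_e$ on the other edges at that node. Its number of block crossings is $\sum_e t(e)$, and $\mathrm{OPT}$ is the minimum over all feasible solutions. **Good pairs.** For every edge $e=(u,v)$ of $P$ add virtual lines $t_e$ and $b_e$ that always stay the topmost and the bottommost line on $e$, start at $u$ and end at $v$, $t_e$ above and $b_e$ below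 $P$. Good pairs are the following ordered pairs of lines sharing an edge. (i) If $a,b$ end at the same node and are consecutive there in clockwise order, then $(a,b)$ is a good pair (lines ending above and lines ending below $P$ are separated by the right edge, except at $v_m$). (ii) If $v$ is an inner node of $P$, $a_1$ is the first line starting at $v$ above $P$ and $a_2$ the last line ending at $v$ above $P$ (first and last from left to right around $v$, virtual lines included), $b$ passes through $v$ and $(a_1,b)$ is good, then $(a_2,b)$ is good and is identified with $(a_1,b)$; symmetrically below $P$. A good pair is *present* in an order if its lines are neighbors in this order; a block crossing that makes it present (not present) *creates* (*breaks*) it. It is *initial* if its lines start at the same node consecutively and in the right order. Identified pairs count as one pair, which exists until the last of them ends. **Algorithm.** Process the edges from left to right. On $e=(u,v)$ call lines ending at $v$ above (below) $P$ red (green), $t_e$ being red and $b_e$ green, and the lines that continue on the next edge black. First bring the red lines, one after the other from the first in the required order, to their place directly below the red lines already placed: a line that is not yet in its place is moved upwards by one block move, together with the maximal sequence of lines below it in which consecutive lines form good pairs. Then bring the green lines to the bottom in the symmetric way. Exception: if the sequence contains red and green lines but not all black lines, it is broken at one of its pairs that contain a black line, and only the part with the line to be moved is moved. It is broken (i) at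 such a pair that was created by a block crossing before, if there is one, and (ii) otherwise at such a pair that ends last. **Theorem.** The algorithm has at least one complete run. Every complete run, whatever choices are made among several admissible pairs in (i) or (ii), yields a feasible solution, and its number of block crossings satisfies $$\mathrm{bc}_{\mathrm{alg}}\le 3\cdot\mathrm{OPT}.$$ Moreover, the rule for breaking sequences of initial good pairs is optimal: the number of distinct initial good pairs that the algorithm breaks is at most the number of distinct initial good pairs broken in any feasible solution, in particular in an optimal one. -/

import Mathlib

/-- An instance of BCM on a path with attached terminals.  The path `P` has the nodes
`v_0, …, v_m` (from left to right) and the edges `e_0, …, e_{m-1}`, where `e_i` joins `v_i` and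
`v_{i+1}`.  Every line `l` of `L` is the simple path between two terminals (nodes of degree one)
attached to the path nodes `first l` and `last l`.

The embedding is given by the clockwise order of the terminals around every path node `v`; every
terminal is named by the only line that ends there.  `above v` lists the terminals above `P`,
clockwise, that is, from the left edge to the right edge of `v`; `below v` lists the terminals below
`P`, clockwise, that is, from the right edge to the left edge.  (At `v_0` and at `v_m`, where one of
the two edges is missing, the splitting of the order into two lists is immaterial.) -/
structure PathNetwork (L : Type*) [DecidableEq L] where
  m : ℕ
  first : L → ℕ
  last : L → ℕ
  first_le_last : ∀ l, first l ≤ last l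
  last_le : ∀ l, last l ≤ m
  above : ℕ → List L
  below : ℕ → List L
  terminals : ∀ v l, (above v ++ below v).count l =
    (if first l = v then 1 else 0) + (if last l = v then 1 else 0)

/-- Line orders `π e 0, …, π e (t e)` for every edge `e`, each listed from top to bottom;
`π e 0` is the order near the left node of `e` and `π e (t e)` the one near the right node.
Only the values with `e < m` and `i ≤ t e` matter. -/
structure LineOrders (L : Type*) where
  t : ℕ → ℕ
  π : ℕ → ℕ → List L

/-- A block move: two consecutive nonempty blocks are exchanged. -/
def BlockMove {L : Type*} (π π' : List L) : Prop :=
  ∃ A B C D : List L, B ≠ [] ∧ C ≠ [] ∧ π = A ++ B ++ C ++ D ∧ π' = A ++ C ++ B ++ D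

/-- The lines that take part in good pairs on an edge `e`: the lines of the instance and the two
virtual lines of `e`, `top` (that is, `t_e`) and `bot` (that is, `b_e`). -/
inductive ELine (L : Type*) where
  | top : ELine L
  | line : L → ELine L
  | bot : ELine L

namespace ELine

/-- The line order together with the virtual lines, which always stay outermost. -/
def ext {L : Type*} (π : List L) : List (ELine L) := top :: π.map line ++ [bot]

end ELine

/-- `x` and `y` are neighbors in the order `π`, and `x` is above `y`. -/
def Together {L : Type*} (π : List L) (p : ELine L × ELine L) : Prop :=
  [p.1, p.2] <:+: ELine.ext π

namespace PathNetwork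

variable {L : Type*} [DecidableEq L] (I : PathNetwork L)

/-- The line `l` passes through the edge `e` of the path, that is, `l ∈ L_e`. -/
abbrev On (e : ℕ) (l : L) : Prop := I.first l ≤ e ∧ e < I.last l

/-! The lines that come from the left edge of `v` and end at `v`, and the lines that start at `v`
and leave through its right edge, always in clockwise order. -/

def endsAbove (v : ℕ) : List L := (I.above v).filter fun l => I.first l < v ∧ I.last l = v
def endsBelow (v : ℕ) : List L := (I.below v).filter fun l => I.first l < v ∧ I.last l = v
def startsAbove (v : ℕ) : List L := (I.above v).filter fun l => I.first l = v ∧ v < I.last l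
def startsBelow (v : ℕ) : List L := (I.below v).filter fun l => I.first l = v ∧ v < I.last l

/-- The order of `L_e` close to the left node `v_e` of `e` that is prescribed by the other edges at
`v_e`: the lines starting at `v_e` and the lines coming from the edge `e - 1`. -/
def leftOrder (S : LineOrders L) (e : ℕ) : List L :=
  (I.startsAbove e).reverse
    ++ (if 0 < e then (S.π (e - 1) (S.t (e - 1))).filter (fun l => I.On e l) else [])
    ++ (I.startsBelow e).reverse

/-- The order of `L_e` close to the right node `v_{e+1}` of `e` that is prescribed by the other
edges at `v_{e+1}`: the lines ending at `v_{e+1}` and the lines continuing on the edge `e + 1`. -/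
def rightOrder (S : LineOrders L) (e : ℕ) : List L :=
  I.endsAbove (e + 1)
    ++ (if e + 1 < I.m then (S.π (e + 1) 0).filter (fun l => I.On e l) else [])
    ++ I.endsBelow (e + 1)

/-- Feasible solutions of BCM. Terminal edges carry one line each, so they need no orders. -/
structure Feasible (S : LineOrders L) : Prop where
  orders : ∀ e < I.m, ∀ i ≤ S.t e, (S.π e i).Nodup ∧ ∀ l, l ∈ S.π e i ↔ I.On e l
  moves : ∀ e < I.m, ∀ i < S.t e, BlockMove (S.π e i) (S.π e (i + 1))
  consistent_left : ∀ e < I.m, S.π e 0 = I.leftOrder S e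
  consistent_right : ∀ e < I.m, S.π e (S.t e) = I.rightOrder S e

/-- The number of block crossings. -/
def cost (S : LineOrders L) : ℕ := ∑ e ∈ Finset.range I.m, S.t e

/-- The minimum number of block crossings of a feasible solution. -/
noncomputable def opt : ℕ := sInf {c | ∃ S, I.Feasible S ∧ I.cost S = c}

/-! ### Good pairs -/

open ELine

/-- The first line starting at `v` above the path. If there is no line of the instance, this is the
virtual line of the right edge of `v`, which is the last one starting there. -/
def firstStartAbove (v : ℕ) : ELine L := ((I.startsAbove v).head?.map line).getD top
/-- The last line ending at `v` above the path (possibly the virtual line of the left edge). -/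
def lastEndAbove (v : ℕ) : ELine L := ((I.endsAbove v).getLast?.map line).getD top
/-- The mirror image of `firstStartAbove` below the path (hence read counterclockwise). -/
def firstStartBelow (v : ℕ) : ELine L := ((I.startsBelow v).getLast?.map line).getD bot
/-- The mirror image of `lastEndAbove` below the path (hence read counterclockwise). -/
def lastEndBelow (v : ℕ) : ELine L := ((I.endsBelow v).head?.map line).getD bot

/-- The lines, with `t_e`, that end to the top after the edge `e`, clockwise. -/
def reds (e : ℕ) : List (ELine L) := top :: (I.endsAbove (e + 1)).map line
/-- The lines, with `b_e`, that end to the bottom after the edge `e`, clockwise. -/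
def greens (e : ℕ) : List (ELine L) := (I.endsBelow (e + 1)).map line ++ [bot]
/-- The lines on `e` that continue on the next edge. -/
def Black (e : ℕ) (x : ELine L) : Prop := ∃ l, x = line l ∧ I.On e l ∧ I.On (e + 1) l

/-- The two lines of the pair end at the right node of `e` and are consecutive there in clockwise
order. Lines ending above and lines ending below are separated by the right edge, except at the last
node of the path. -/
def EndConsecutive (e : ℕ) (p : ELine L × ELine L) : Prop :=
  [p.1, p.2] <:+: I.reds e ∨ [p.1, p.2] <:+: I.greens e ∨
    (e + 1 = I.m ∧ [p.1, p.2] <:+: I.reds e ++ I.greens e)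

/-- The pair `p` on the edge `e` is identified with the pair `q` on the edge `e + 1`: either it is
the same pair of lines, or `p` inherits from `q` above or below the path. -/
def Identified (e : ℕ) (p q : ELine L × ELine L) : Prop :=
  (I.Black e p.1 ∧ I.Black e p.2 ∧ q = p) ∨
  (I.Black e p.2 ∧ p.1 = I.lastEndAbove (e + 1) ∧ q = (I.firstStartAbove (e + 1), p.2)) ∨
  (I.Black e p.1 ∧ p.2 = I.lastEndBelow (e + 1) ∧ q = (p.1, I.firstStartBelow (e + 1)))

/-- `GoodPair e (a, b)`: the lines `a` and `b` both exist on `e`, and `(a, b)` is a good pair. -/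
inductive GoodPair : ℕ → ELine L × ELine L → Prop
  | ending (e : ℕ) (p : ELine L × ELine L) : e < I.m → I.EndConsecutive e p → GoodPair e p
  | inherit (e : ℕ) (p q : ELine L × ELine L) :
      I.Identified e p q → GoodPair (e + 1) q → GoodPair e p

/-- The good pair `p` on `e` and the good pair `q` on a later (or the same) edge `f` are linked by
identifications. -/
inductive Linked (e : ℕ) (p : ELine L × ELine L) : ℕ → ELine L × ELine L → Prop
  | refl : I.GoodPair e p → Linked e p e p
  | next (f : ℕ) (q r : ELine L × ELine L) :
      Linked e p f q → I.Identified f q r → I.GoodPair (f + 1) r → Linked e p (f + 1) r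

/-- The good pair `p` on the edge `e`, up to identification, still exists on the edge `f`. -/
def ExistsUntil (e : ℕ) (p : ELine L × ELine L) (f : ℕ) : Prop := ∃ q, I.Linked e p f q

/-- The good pair `p` on `e`, up to identification, was created by one of the block crossings that
precede the order `π e i`. -/
def Created (S : LineOrders L) (e i : ℕ) (p : ELine L × ELine L) : Prop :=
  ∃ f q j, I.Linked f q e p ∧ (f < e ∧ j < S.t f ∨ f = e ∧ j < i) ∧
    ¬ Together (S.π f j) q ∧ Together (S.π f (j + 1)) q

/-- Initial good pairs: both lines start at the left node of `e`, consecutively and in the right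
order. (The lines starting above and the lines starting below are consecutive if and only if no line
arrives from the edge `e - 1` and continues.) -/
def InitialPair (e : ℕ) (p : ELine L × ELine L) : Prop :=
  I.GoodPair e p ∧
    ([p.1, p.2] <:+: top :: (I.startsAbove e).reverse.map line ∨
     [p.1, p.2] <:+: (I.startsBelow e).reverse.map line ++ [bot] ∨
     ((∀ l, I.On e l → I.first l = e) ∧ [p.1, p.2] <:+:
        top :: (I.startsAbove e).reverse.map line ++ ((I.startsBelow e).reverse.map line ++ [bot])))

/-- The initial good pairs that are broken by some block crossing. Identified pairs are counted
once: every pair is represented by its first edge. -/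
def brokenInitial (S : LineOrders L) : Set (ℕ × ELine L × ELine L) :=
  {x | I.InitialPair x.1 x.2 ∧ ∃ f q j, I.Linked x.1 x.2 f q ∧ j < S.t f ∧
    Together (S.π f j) q ∧ ¬ Together (S.π f (j + 1)) q}

/-! ### The algorithm -/

/-- `s` consists of the red lines that are already at the top of `π` in the right order, and `r` is
the next red line, which has to be moved. -/
def NextRed (e : ℕ) (π : List L) (s : List (ELine L)) (r : L) : Prop :=
  s ++ [line r] <+: I.reds e ∧ s <+: ext π ∧ ¬ s ++ [line r] <+: ext π

/-- `s` consists of the green lines that are already at the bottom of `π` in the right order, and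
`g` is the next green line, which has to be moved. -/
def NextGreen (e : ℕ) (π : List L) (g : L) (s : List (ELine L)) : Prop :=
  line g :: s <:+ I.greens e ∧ s <:+ ext π ∧ ¬ line g :: s <:+ ext π

/-- Consecutive lines are linked by good pairs. -/
def GoodSequence (e : ℕ) (b : List (ELine L)) : Prop := b.IsChain fun x y => I.GoodPair e (x, y)

/-- `b` starts with `r` and extends downwards as long as the lines are linked by good pairs. -/
def DownBlock (e : ℕ) (π : List L) (r : L) (b : List (ELine L)) : Prop :=
  ∃ A C, ext π = A ++ b ++ C ∧ b.head? = some (line r) ∧ I.GoodSequence e b ∧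
    ∀ x ∈ b.getLast?, ∀ y ∈ C.head?, ¬ I.GoodPair e (x, y)

/-- `b` ends with `g` and extends upwards as long as the lines are linked by good pairs. -/
def UpBlock (e : ℕ) (π : List L) (g : L) (b : List (ELine L)) : Prop :=
  ∃ A C, ext π = A ++ b ++ C ∧ b.getLast? = some (line g) ∧ I.GoodSequence e b ∧
    ∀ x ∈ A.getLast?, ∀ y ∈ b.head?, ¬ I.GoodPair e (x, y)

/-- The sequence `b` contains red and green lines, but not all black lines. -/
def MustBreak (e : ℕ) (b : List (ELine L)) : Prop :=
  (∃ x ∈ b, x ∈ I.reds e) ∧ (∃ x ∈ b, x ∈ I.greens e) ∧ ∃ x, I.Black e x ∧ x ∉ b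

/-- A pair of consecutive lines of `b` that contains a black line. -/
def BlackPair (e : ℕ) (b : List (ELine L)) (p : ELine L × ELine L) : Prop :=
  [p.1, p.2] <:+: b ∧ (I.Black e p.1 ∨ I.Black e p.2)

/-- The pair `p` is a pair at which the algorithm may break the sequence `b` in the order `π e i`:
(i) a pair that was created by a crossing; or, if there is none, (ii) a pair that ends last. -/
def BreakAt (S : LineOrders L) (e i : ℕ) (b : List (ELine L)) (p : ELine L × ELine L) : Prop :=
  I.BlackPair e b p ∧
    (I.Created S e i p ∨
      (∀ q, I.BlackPair e b q → ¬ I.Created S e i q) ∧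
      ∀ q, I.BlackPair e b q → ∀ f, I.ExistsUntil e q f → I.ExistsUntil e p f)

/-- A move of the algorithm on `e` that brings the next red line to the top. -/
def RedMove (S : LineOrders L) (e i : ℕ) : Prop :=
  ∃ s r b moved, I.NextRed e (S.π e i) s r ∧ I.DownBlock e (S.π e i) r b ∧
    (¬ I.MustBreak e b ∧ moved = b ∨
      I.MustBreak e b ∧ ∃ B C x y, b = B ++ x :: y :: C ∧ I.BreakAt S e i b (x, y) ∧
        moved = B ++ [x]) ∧
    ∃ M R, ext (S.π e i) = s ++ M ++ moved ++ R ∧ ext (S.π e (i + 1)) = s ++ moved ++ M ++ R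

/-- A move of the algorithm on `e`, after all red lines are in place, that brings the next green
line to the bottom. -/
def GreenMove (S : LineOrders L) (e i : ℕ) : Prop :=
  I.reds e <+: ext (S.π e i) ∧
  ∃ g s b moved, I.NextGreen e (S.π e i) g s ∧ I.UpBlock e (S.π e i) g b ∧
    (¬ I.MustBreak e b ∧ moved = b ∨
      I.MustBreak e b ∧ ∃ B C x y, b = B ++ x :: y :: C ∧ I.BreakAt S e i b (x, y) ∧
        moved = y :: C) ∧
    ∃ R M, ext (S.π e i) = R ++ moved ++ M ++ s ∧ ext (S.π e (i + 1)) = R ++ M ++ moved ++ s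

/-- The line orders `S` are produced by a run of the algorithm: the edges are processed from left to
right; on every edge first the red and then the green lines are brought to their places. Where the
algorithm leaves a choice (between several pairs of case (i), or several pairs of case (ii) that end
last), every choice is a run. -/
structure AlgorithmRun (S : LineOrders L) : Prop where
  start : ∀ e < I.m, S.π e 0 = I.leftOrder S e
  move : ∀ e < I.m, ∀ i < S.t e, I.RedMove S e i ∨ I.GreenMove S e i
  finish : ∀ e < I.m, I.reds e <+: ext (S.π e (S.t e)) ∧ I.greens e <:+ ext (S.π e (S.t e))

end PathNetwork

/-! The proof counts creations of good pairs, where a class of identified pairs counts once and is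
represented by its last pair. Lines that end consecutively at a node are neighbors when they reach
it, so in every feasible solution every class is present at its end. Hence a class that does not
begin with an initial pair must be created, and one that does is created if and only if that initial
pair is broken. The number of created classes is thus a constant of the instance plus the number of
broken initial pairs (`Feasible.ncard_createdEnding`).

A block move makes only three new adjacencies, so a solution with `c` block crossings creates at
most `3 * c` classes (`Feasible.ncard_createdEnding_le`). Conversely, each move of the algorithm
makes a line the neighbor of its predecessor in the required order, and this adjacency lasts to the
end of the edge; distinct moves therefore create distinct classes (`AlgorithmRun.cost_le`). It
remains to see that the algorithm breaks the fewest initial pairs.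

A move of the algorithm breaks at most one good pair, and only where a sequence must be broken
(`RedMove.spec`, `GreenMove.spec`). The first break of an initial pair falls under rule (ii): no
pair with a black line in the sequence was created before, so all of them stem from initial pairs.
No feasible solution keeps them all (`Feasible.exists_not_together`): at the right end of the edge
the black lines lie between the red and the green ones, so an intact sequence from red to green
would contain every black line. The break is charged to a pair that the other solution loses.
Charges are distinct (`Feasible.not_linked_of_breaksUncreated`): the algorithm broke a pair that
ends last, so if the charged pair occurred in a later sequence, the broken pair would be back in
that sequence, hence created meanwhile, and rule (i) would have applied.

A complete run exists because a block that need not be broken never has to carry a virtual line away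
(`downBlock_not_reaching_bottom`, `upBlock_not_reaching_top`). -/

namespace List

/-! ### Lists: adjacent entries, exchanged blocks, chains of a relation. -/

variable {α : Type*} {R : α → α → Prop}

theorem pair_infix_iff {x y : α} {l : List α} : [x, y] <:+: l ↔ ∃ u v, l = u ++ x :: y :: v := by
  constructor
  · rintro ⟨u, v, rfl⟩; exact ⟨u, v, by simp⟩
  · rintro ⟨u, v, rfl⟩; exact ⟨u, v, by simp⟩

theorem pair_infix_append {x y : α} {l l' : List α} :
    [x, y] <:+: l ++ l' ↔
      [x, y] <:+: l ∨ [x, y] <:+: l' ∨ (l.getLast? = some x ∧ l'.head? = some y) := by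
  constructor
  · rw [pair_infix_iff]
    rintro ⟨u, v, h⟩
    rcases List.append_eq_append_iff.1 h with ⟨w, rfl, hw⟩ | ⟨w, rfl, hw⟩
    · exact Or.inr (Or.inl (pair_infix_iff.2 ⟨w, v, hw⟩))
    · rcases w with _ | ⟨a, _ | ⟨b, w⟩⟩
      · exact Or.inr (Or.inl (pair_infix_iff.2 ⟨[], v, by simpa using hw.symm⟩))
      · obtain ⟨rfl, rfl⟩ : x = a ∧ y :: v = l' := by simpa using hw
        exact Or.inr (Or.inr (by simp))
      · obtain ⟨rfl, rfl, rfl⟩ : x = a ∧ y = b ∧ v = w ++ l' := by simpa using hw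
        exact Or.inl (pair_infix_iff.2 ⟨u, w, rfl⟩)
  · rintro (h | h | ⟨h, h'⟩)
    · exact h.trans (infix_append_left)
    · exact h.trans (infix_append_right)
    · obtain ⟨u, rfl⟩ := getLast?_eq_some_iff.1 h
      obtain ⟨v, rfl⟩ := head?_eq_some_iff.1 h'
      exact ⟨u, v, by simp⟩

theorem mem_left_of_pair_infix {x y : α} {l : List α} (h : [x, y] <:+: l) : x ∈ l :=
  h.subset (by simp)

theorem mem_right_of_pair_infix {x y : α} {l : List α} (h : [x, y] <:+: l) : y ∈ l :=
  h.subset (by simp)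

theorem Nodup.append_cons_inj {x : α} {u u' v v' : List α} (h : (u ++ x :: v).Nodup)
    (e : u ++ x :: v = u' ++ x :: v') : u = u' ∧ v = v' := by
  have h1 : x ∉ u' ∧ x ∉ v' := by
    rw [e, nodup_middle, nodup_cons, mem_append, not_or] at h
    exact h.1
  have h2 := (append_cons_inj_of_notMem h1.1 h1.2).1 e.symm
  exact ⟨h2.1.symm, h2.2.2.symm⟩

theorem Nodup.pair_infix_right_unique {x y z : α} {l : List α} (h : l.Nodup)
    (hy : [x, y] <:+: l) (hz : [x, z] <:+: l) : y = z := by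
  obtain ⟨u, v, rfl⟩ := pair_infix_iff.1 hy
  obtain ⟨u', v', e⟩ := pair_infix_iff.1 hz
  have := (h.append_cons_inj e).2
  simp at this; exact this.1

theorem Nodup.pair_infix_left_unique {x y z : α} {l : List α} (h : l.Nodup)
    (hy : [y, x] <:+: l) (hz : [z, x] <:+: l) : y = z := by
  refine (nodup_reverse.2 h).pair_infix_right_unique (x := x) ?_ ?_
  · simpa using reverse_infix.2 hy
  · simpa using reverse_infix.2 hz

theorem Nodup.not_pair_infix_of_getLast? {x y : α} {l : List α} (h : l.Nodup)
    (hx : l.getLast? = some x) : ¬ [x, y] <:+: l := by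
  intro hy
  obtain ⟨u, v, rfl⟩ := pair_infix_iff.1 hy
  obtain ⟨w, e⟩ := getLast?_eq_some_iff.1 hx
  have := (h.append_cons_inj e).2
  simp at this

theorem Nodup.not_pair_infix_of_head? {x y : α} {l : List α} (h : l.Nodup)
    (hx : l.head? = some x) : ¬ [y, x] <:+: l := by
  intro hy
  refine (nodup_reverse.2 h).not_pair_infix_of_getLast? (x := x) (y := y) (by simpa using hx) ?_
  simpa using reverse_infix.2 hy

/-- Exchanging two consecutive blocks separates at most the pairs at the three junctions. -/
theorem pair_infix_swap {x y : α} {A B C D : List α} (h : [x, y] <:+: A ++ B ++ C ++ D)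
    (hB : B ≠ []) (hC : C ≠ []) :
    [x, y] <:+: A ++ C ++ B ++ D ∨ (A.getLast? = some x ∧ B.head? = some y) ∨
      (B.getLast? = some x ∧ C.head? = some y) ∨ (C.getLast? = some x ∧ D.head? = some y) := by
  rw [append_assoc, append_assoc] at h ⊢
  have hhB : (B ++ (C ++ D)).head? = B.head? := by
    cases B <;> simp_all
  have hhC : (C ++ D).head? = C.head? := by
    cases C <;> simp_all
  rcases pair_infix_append.1 h with h | h | h
  · exact Or.inl (h.trans infix_append_left)
  · rcases pair_infix_append.1 h with h | h | h
    · left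
      exact h.trans (infix_append_left.trans (infix_append_right.trans infix_append_right))
    · rcases pair_infix_append.1 h with h | h | h
      · exact Or.inl (h.trans (infix_append_left.trans infix_append_right))
      · left
        exact h.trans (infix_append_right.trans (infix_append_right.trans infix_append_right))
      · exact Or.inr (Or.inr (Or.inr h))
    · rw [hhC] at h
      exact Or.inr (Or.inr (Or.inl h))
  · rw [hhB] at h
    exact Or.inr (Or.inl h)

theorem exists_maximal_chain_prefix (R : α → α → Prop) (a : α) (l : List α) :
    ∃ b C, a :: l = b ++ C ∧ b.head? = some a ∧ b.IsChain R ∧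
      ∀ x ∈ b.getLast?, ∀ y ∈ C.head?, ¬ R x y := by
  induction l generalizing a with
  | nil => exact ⟨[a], [], by simp⟩
  | cons c l ih =>
    by_cases h : R a c
    · obtain ⟨b, C, h1, h2, h3, h4⟩ := ih c
      obtain ⟨b, rfl⟩ := head?_eq_some_iff.1 h2
      refine ⟨a :: c :: b, C, by simp [h1], by simp, isChain_cons_cons.2 ⟨h, h3⟩, ?_⟩
      simpa using h4
    · exact ⟨[a], c :: l, by simp [h]⟩

theorem exists_maximal_chain_suffix (R : α → α → Prop) (a : α) (l : List α) :
    ∃ A b, l ++ [a] = A ++ b ∧ b.getLast? = some a ∧ b.IsChain R ∧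
      ∀ x ∈ A.getLast?, ∀ y ∈ b.head?, ¬ R x y := by
  obtain ⟨b, C, h1, h2, h3, h4⟩ := exists_maximal_chain_prefix (fun x y => R y x) a l.reverse
  refine ⟨C.reverse, b.reverse, ?_, by simpa using h2, by simpa using isChain_reverse.2 h3, ?_⟩
  · rw [← reverse_append, ← h1]; simp
  · intro x hx y hy
    simp only [getLast?_reverse, head?_reverse] at hx hy
    exact h4 y hy x hx

theorem IsChain.rel_of_pair_infix {x y : α} {l : List α} (h : l.IsChain R)
    (hxy : [x, y] <:+: l) : R x y := by
  have := h.infix hxy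
  simpa using this

theorem isChain_iff_pair_infix {l : List α} : l.IsChain R ↔ ∀ x y, [x, y] <:+: l → R x y := by
  refine ⟨fun h x y => h.rel_of_pair_infix, fun h => ?_⟩
  induction l with
  | nil => simp
  | cons a l ih =>
    cases l with
    | nil => simp
    | cons b l =>
      exact isChain_cons_cons.2 ⟨h a b ⟨[], l, by simp⟩,
        ih fun x y hxy => h x y (hxy.trans (suffix_cons _ _).isInfix)⟩

/-- When successors are unique, a chain is determined by its first entry up to its length. Good
pairs are such a relation, in both directions. -/
theorem IsChain.prefix_or_prefix (hR : ∀ x y z, R x y → R x z → y = z) {l l' : List α} {a : α}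
    (h : (a :: l).IsChain R) (h' : (a :: l').IsChain R) :
    a :: l <+: a :: l' ∨ a :: l' <+: a :: l := by
  induction l generalizing a l' with
  | nil => left; simp
  | cons b l ih =>
    cases l' with
    | nil => right; simp
    | cons c l' =>
      rw [isChain_cons_cons] at h h'
      obtain rfl := hR _ _ _ h.1 h'.1
      rcases ih h.2 h'.2 with H | H
      · left; exact (prefix_cons_inj a).2 H
      · right; exact (prefix_cons_inj a).2 H

theorem IsChain.suffix_or_suffix (hR : ∀ x y z, R x z → R y z → x = y) {l l' : List α} {a : α}
    (h : (l ++ [a]).IsChain R) (h' : (l' ++ [a]).IsChain R) :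
    l ++ [a] <:+ l' ++ [a] ∨ l' ++ [a] <:+ l ++ [a] := by
  have := IsChain.prefix_or_prefix (R := fun x y => R y x) (fun x y z h h' => hR _ _ _ h h')
    (l := l.reverse) (l' := l'.reverse) (a := a)
    (by simpa using isChain_reverse.2 h) (by simpa using isChain_reverse.2 h')
  refine this.imp (fun h => ?_) (fun h => ?_)
  · simpa using reverse_suffix.2 h
  · simpa using reverse_suffix.2 h

/-- A property that is inherited upwards along a chain holds exactly on a prefix. -/
theorem IsChain.exists_split {P : α → Prop} (hP : ∀ x y, R x y → P y → P x) {l : List α}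
    (h : l.IsChain R) (h1 : ∃ x ∈ l, P x) (h2 : ∃ x ∈ l, ¬ P x) :
    ∃ u x y v, l = u ++ x :: y :: v ∧ P x ∧ ¬ P y := by
  induction l with
  | nil => simp at h1
  | cons a l ih =>
    cases l with
    | nil => simp at h1 h2; tauto
    | cons b l =>
      rw [isChain_cons_cons] at h
      by_cases hb : P b
      · have ha := hP _ _ h.1 hb
        obtain ⟨u, x, y, v, e, hx, hy⟩ := ih h.2 ⟨b, by simp, hb⟩ (by
          obtain ⟨x, hx, hx'⟩ := h2
          rcases mem_cons.1 hx with rfl | hx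
          · exact absurd ha hx'
          · exact ⟨x, hx, hx'⟩)
        exact ⟨a :: u, x, y, v, by simp [e], hx, hy⟩
      · by_cases ha : P a
        · exact ⟨[], a, b, l, by simp, ha, hb⟩
        · obtain ⟨u, x, y, v, e, hx, hy⟩ := ih h.2 (by
            obtain ⟨x, hx, hx'⟩ := h1
            rcases mem_cons.1 hx with rfl | hx
            · exact absurd hx' ha
            · exact ⟨x, hx, hx'⟩) ⟨b, by simp, hb⟩
          exact ⟨a :: u, x, y, v, by simp [e], hx, hy⟩

theorem IsChain.forall_of_head {P : α → Prop} (hP : ∀ x y, R x y → P x → P y) {l : List α} {a : α}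
    (h : (a :: l).IsChain R) (ha : P a) : ∀ x ∈ a :: l, P x := by
  induction l generalizing a with
  | nil => simpa using ha
  | cons b l ih =>
    rw [isChain_cons_cons] at h
    intro x hx
    rcases mem_cons.1 hx with rfl | hx
    · exact ha
    · exact ih h.2 (hP _ _ h.1 ha) x hx

theorem IsChain.forall_of_getLast {P : α → Prop} (hP : ∀ x y, R x y → P y → P x) {l : List α}
    {a : α} (h : (l ++ [a]).IsChain R) (ha : P a) : ∀ x ∈ l ++ [a], P x := by
  have := IsChain.forall_of_head (R := fun x y => R y x) (P := P) (fun x y h h' => hP _ _ h h')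
    (l := l.reverse) (a := a) (by simpa using isChain_reverse.2 h) ha
  intro x hx
  exact this x (by simpa [or_comm] using hx)

theorem pair_infix_iff_of_disjoint_left {x y : α} {A B : List α} (hx : x ∉ A) :
    [x, y] <:+: A ++ B ↔ [x, y] <:+: B := by
  rw [pair_infix_append]
  refine ⟨?_, fun h => Or.inr (Or.inl h)⟩
  rintro (h | h | h)
  · exact absurd (mem_left_of_pair_infix h) hx
  · exact h
  · exact absurd (mem_of_getLast? h.1) hx

theorem pair_infix_iff_of_disjoint_right {x y : α} {A B : List α} (hy : y ∉ B) :
    [x, y] <:+: A ++ B ↔ [x, y] <:+: A := by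
  rw [pair_infix_append]
  refine ⟨?_, fun h => Or.inl h⟩
  rintro (h | h | h)
  · exact h
  · exact absurd (mem_right_of_pair_infix h) hy
  · exact absurd (mem_of_head? h.2) hy

theorem exists_adjacent_of_ne_nil {s : List α} (hs : s ≠ []) (a : α) :
    ∃ c, s.getLast? = some c ∧ [c, a] <:+: s ++ [a] := by
  obtain ⟨c, hc⟩ := Option.isSome_iff_exists.1 (getLast?_isSome.2 hs)
  exact ⟨c, hc, pair_infix_append.2 (Or.inr (Or.inr ⟨hc, by simp⟩))⟩

end List

/-! ### Line orders extended by the two virtual lines. -/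

namespace ELine

variable {L : Type*}

theorem line_injective : Function.Injective (line : L → ELine L) := fun _ _ h => by simpa using h

theorem nodup_ext {π : List L} : (ext π).Nodup ↔ π.Nodup := by
  simp [ext, List.nodup_append, List.nodup_map_iff line_injective]

theorem mem_ext {π : List L} {x : ELine L} :
    x ∈ ext π ↔ x = top ∨ x = bot ∨ ∃ l ∈ π, x = line l := by
  simp only [ext, List.cons_append, List.mem_cons, List.mem_append, List.mem_map, List.not_mem_nil,
    or_false]
  constructor
  · rintro (h | ⟨l, hl, rfl⟩ | h) <;> simp_all
  · rintro (h | h | ⟨l, hl, rfl⟩) <;> simp_all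

instance [Finite L] : Finite (ELine L) := by
  refine Finite.of_surjective (α := Option (Option L))
    (fun | none => top | some none => bot | some (some l) => line l) ?_
  rintro (_ | l | _)
  · exact ⟨none, rfl⟩
  · exact ⟨some (some l), rfl⟩
  · exact ⟨some none, rfl⟩

end ELine

/-! ### Lines ending and starting at a node; red, green and black lines. -/

namespace PathNetwork

open ELine

variable {L : Type*} [DecidableEq L] (I : PathNetwork L)

/-- A line that survives the filter starts before `v`, so `terminals` gives it exactly one terminal
at `v`; a line with both terminals at `v` is filtered out. -/
theorem endsAbove_endsBelow (v : ℕ) :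
    (I.endsAbove v ++ I.endsBelow v).Nodup ∧
      ∀ l, l ∈ I.endsAbove v ++ I.endsBelow v ↔ I.first l < v ∧ I.last l = v := by
  have e : I.endsAbove v ++ I.endsBelow v =
      (I.above v ++ I.below v).filter fun l => I.first l < v ∧ I.last l = v := by
    rw [List.filter_append]; rfl
  rw [e]
  constructor
  · refine List.nodup_iff_count_le_one.2 fun l => ?_
    by_cases h : I.first l < v ∧ I.last l = v
    · rw [List.count_filter (by simpa using h), I.terminals]
      split_ifs <;> omega
    · rw [List.count_eq_zero_of_not_mem]
      · omega
      · simp only [List.mem_filter, decide_eq_true_eq]; tauto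
  · intro l
    simp only [List.mem_filter, decide_eq_true_eq, and_iff_right_iff_imp]
    intro h
    rw [← List.count_pos_iff, I.terminals]
    simp [h.2]

theorem startsAbove_startsBelow (v : ℕ) :
    (I.startsAbove v ++ I.startsBelow v).Nodup ∧
      ∀ l, l ∈ I.startsAbove v ++ I.startsBelow v ↔ I.first l = v ∧ v < I.last l := by
  have e : I.startsAbove v ++ I.startsBelow v =
      (I.above v ++ I.below v).filter fun l => I.first l = v ∧ v < I.last l := by
    rw [List.filter_append]; rfl
  rw [e]
  constructor
  · refine List.nodup_iff_count_le_one.2 fun l => ?_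
    by_cases h : I.first l = v ∧ v < I.last l
    · rw [List.count_filter (by simpa using h), I.terminals]
      split_ifs <;> omega
    · rw [List.count_eq_zero_of_not_mem]
      · omega
      · simp only [List.mem_filter, decide_eq_true_eq]; tauto
  · intro l
    simp only [List.mem_filter, decide_eq_true_eq, and_iff_right_iff_imp]
    intro h
    rw [← List.count_pos_iff, I.terminals]
    simp [h.1]

theorem nodup_reds_append_greens (e : ℕ) : (I.reds e ++ I.greens e).Nodup := by
  have h : I.reds e ++ I.greens e = ext (I.endsAbove (e + 1) ++ I.endsBelow (e + 1)) := by
    simp [reds, greens, ext]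
  rw [h, nodup_ext]
  exact (I.endsAbove_endsBelow _).1

theorem nodup_reds (e : ℕ) : (I.reds e).Nodup := (I.nodup_reds_append_greens e).of_append_left

theorem nodup_greens (e : ℕ) : (I.greens e).Nodup := (I.nodup_reds_append_greens e).of_append_right

variable {I}

theorem not_green_of_red {e : ℕ} {x : ELine L} (h : x ∈ I.reds e) : x ∉ I.greens e :=
  fun h' => (List.nodup_append.1 (I.nodup_reds_append_greens e)).2.2 x h x h' rfl

theorem not_red_of_green {e : ℕ} {x : ELine L} (h : x ∈ I.greens e) : x ∉ I.reds e :=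
  fun h' => not_green_of_red h' h

theorem last_eq_of_red_or_green {e : ℕ} {l : L} (h : line l ∈ I.reds e ∨ line l ∈ I.greens e) :
    I.first l < e + 1 ∧ I.last l = e + 1 := by
  rw [← (I.endsAbove_endsBelow _).2, List.mem_append]
  simpa [reds, greens] using h

theorem Black.not_red {e : ℕ} {x : ELine L} (h : I.Black e x) : x ∉ I.reds e := by
  obtain ⟨l, rfl, -, h⟩ := h
  intro hx
  have := last_eq_of_red_or_green (Or.inl hx)
  omega

theorem Black.not_green {e : ℕ} {x : ELine L} (h : I.Black e x) : x ∉ I.greens e := by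
  obtain ⟨l, rfl, -, h⟩ := h
  intro hx
  have := last_eq_of_red_or_green (Or.inr hx)
  omega

theorem Black.lt_m {e : ℕ} {x : ELine L} (h : I.Black e x) : e + 1 < I.m := by
  obtain ⟨l, rfl, -, h⟩ := h
  have := I.last_le l
  omega

variable (I)

/-- The lines that start at the left node of `e` above `P`, from top to bottom, with the
virtual line. -/
def tops (e : ℕ) : List (ELine L) := top :: (I.startsAbove e).reverse.map line
/-- The lines that start at the left node of `e` below `P`, from top to bottom, with the
virtual line. -/
def bots (e : ℕ) : List (ELine L) := (I.startsBelow e).reverse.map line ++ [bot]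

theorem getLast?_tops (e : ℕ) : (I.tops e).getLast? = some (I.firstStartAbove e) := by
  unfold tops firstStartAbove
  cases h : I.startsAbove e <;> simp [List.getLast?_cons]

theorem head?_bots (e : ℕ) : (I.bots e).head? = some (I.firstStartBelow e) := by
  unfold bots firstStartBelow
  rcases List.eq_nil_or_concat (I.startsBelow e) with h | ⟨l, a, h⟩ <;> simp [h]

theorem getLast?_reds (e : ℕ) : (I.reds e).getLast? = some (I.lastEndAbove (e + 1)) := by
  unfold reds lastEndAbove
  rcases List.eq_nil_or_concat (I.endsAbove (e + 1)) with h | ⟨l, a, h⟩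
  · simp [h]
  · rw [h]; simp [List.getLast?_cons]

theorem head?_greens (e : ℕ) : (I.greens e).head? = some (I.lastEndBelow (e + 1)) := by
  unfold greens lastEndBelow
  cases h : I.endsBelow (e + 1) <;> simp

theorem lastEndAbove_mem (e : ℕ) : I.lastEndAbove (e + 1) ∈ I.reds e :=
  List.mem_of_getLast? (I.getLast?_reds e)

theorem lastEndBelow_mem (e : ℕ) : I.lastEndBelow (e + 1) ∈ I.greens e :=
  List.mem_of_head? (I.head?_greens e)

variable {I}

theorem first_eq_of_starts {e : ℕ} {l : L} (h : line l ∈ I.tops e ∨ line l ∈ I.bots e) :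
    I.first l = e ∧ e < I.last l := by
  rw [← (I.startsAbove_startsBelow _).2, List.mem_append]
  simpa [tops, bots] using h

theorem Black.not_starts {e : ℕ} {x : ELine L} (h : I.Black e x) :
    x ∉ I.tops (e + 1) ∧ x ∉ I.bots (e + 1) := by
  obtain ⟨l, rfl, h, -⟩ := h
  refine not_or.1 fun hx => ?_
  have := first_eq_of_starts hx
  omega

theorem not_black_firstStartAbove {e : ℕ} : ¬ I.Black e (I.firstStartAbove (e + 1)) :=
  fun h => h.not_starts.1 (List.mem_of_getLast? (I.getLast?_tops _))

theorem not_black_firstStartBelow {e : ℕ} : ¬ I.Black e (I.firstStartBelow (e + 1)) :=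
  fun h => h.not_starts.2 (List.mem_of_head? (I.head?_bots _))

theorem not_black_lastEndAbove {e : ℕ} : ¬ I.Black e (I.lastEndAbove (e + 1)) :=
  fun h => h.not_red (I.lastEndAbove_mem e)

theorem not_black_lastEndBelow {e : ℕ} : ¬ I.Black e (I.lastEndBelow (e + 1)) :=
  fun h => h.not_green (I.lastEndBelow_mem e)

/-! ### Identification -/

/-- The clauses of `Identified` exclude each other, since the last lines ending above and below are
not black. For `left_unique` the same role is played by the first starting lines, which do not come
from the edge `e`. -/
theorem Identified.right_unique {e : ℕ} {p q q' : ELine L × ELine L} (h : I.Identified e p q)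
    (h' : I.Identified e p q') : q = q' := by
  have h1 := @not_black_lastEndAbove L _ I e
  have h2 := @not_black_lastEndBelow L _ I e
  rcases h with ⟨ha, hb, rfl⟩ | ⟨ha, hb, rfl⟩ | ⟨ha, hb, rfl⟩ <;>
  rcases h' with ⟨ha', hb', rfl⟩ | ⟨ha', hb', rfl⟩ | ⟨ha', hb', rfl⟩ <;>
  simp_all

theorem Identified.left_unique {e : ℕ} {p p' q : ELine L × ELine L} (h : I.Identified e p q)
    (h' : I.Identified e p' q) : p = p' := by
  have h1 := @not_black_firstStartAbove L _ I e
  have h2 := @not_black_firstStartBelow L _ I e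
  obtain ⟨p1, p2⟩ := p
  obtain ⟨p1', p2'⟩ := p'
  rcases h with ⟨ha, hb, rfl⟩ | ⟨ha, hb, rfl⟩ | ⟨ha, hb, rfl⟩ <;>
  rcases h' with ⟨ha', hb', e'⟩ | ⟨ha', hb', e'⟩ | ⟨ha', hb', e'⟩ <;>
  simp_all

theorem Identified.black {e : ℕ} {p q : ELine L × ELine L} (h : I.Identified e p q) :
    I.Black e p.1 ∨ I.Black e p.2 := by
  rcases h with h | h | h
  · exact Or.inl h.1
  · exact Or.inr h.1
  · exact Or.inl h.1

theorem Identified.fst_not_green {e : ℕ} {p q : ELine L × ELine L} (h : I.Identified e p q) :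
    p.1 ∉ I.greens e := by
  rcases h with h | h | h
  · exact h.1.not_green
  · rw [h.2.1]; exact not_green_of_red (I.lastEndAbove_mem e)
  · exact h.1.not_green

theorem Identified.snd_not_red {e : ℕ} {p q : ELine L × ELine L} (h : I.Identified e p q) :
    p.2 ∉ I.reds e := by
  rcases h with h | h | h
  · exact h.2.1.not_red
  · exact h.1.not_red
  · rw [h.2.1]; exact not_red_of_green (I.lastEndBelow_mem e)

theorem Identified.snd_eq {e : ℕ} {p q : ELine L × ELine L} (h : I.Identified e p q)
    (hb : I.Black e p.2) : q.2 = p.2 := by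
  rcases h with ⟨_, _, rfl⟩ | ⟨_, _, rfl⟩ | ⟨_, h, _⟩
  · rfl
  · rfl
  · rw [h] at hb; exact absurd hb not_black_lastEndBelow

theorem Identified.fst_eq {e : ℕ} {p q : ELine L × ELine L} (h : I.Identified e p q)
    (hb : I.Black e p.1) : q.1 = p.1 := by
  rcases h with ⟨_, _, rfl⟩ | ⟨_, h, _⟩ | ⟨_, _, rfl⟩
  · rfl
  · rw [h] at hb; exact absurd hb not_black_lastEndAbove
  · rfl

/-! ### Good pairs -/

theorem EndConsecutive.infix {e : ℕ} {p : ELine L × ELine L} (h : I.EndConsecutive e p) :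
    [p.1, p.2] <:+: I.reds e ++ I.greens e := by
  rcases h with h | h | h
  · exact h.trans List.infix_append_left
  · exact h.trans List.infix_append_right
  · exact h.2

theorem EndConsecutive.not_black {e : ℕ} {p : ELine L × ELine L} (h : I.EndConsecutive e p) :
    ¬ I.Black e p.1 ∧ ¬ I.Black e p.2 := by
  have h1 := List.mem_append.1 (List.mem_left_of_pair_infix h.infix)
  have h2 := List.mem_append.1 (List.mem_right_of_pair_infix h.infix)
  exact ⟨fun hb => h1.elim hb.not_red hb.not_green, fun hb => h2.elim hb.not_red hb.not_green⟩

theorem EndConsecutive.not_identified {e : ℕ} {p q : ELine L × ELine L}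
    (h : I.EndConsecutive e p) : ¬ I.Identified e p q :=
  fun h' => h'.black.elim h.not_black.1 h.not_black.2

theorem EndConsecutive.of_lt {e : ℕ} {p : ELine L × ELine L} (h : I.EndConsecutive e p)
    (he : e + 1 < I.m) : [p.1, p.2] <:+: I.reds e ∨ [p.1, p.2] <:+: I.greens e := by
  rcases h with h | h | h
  · exact Or.inl h
  · exact Or.inr h
  · omega

theorem EndConsecutive.fst_ne_lastEndAbove {e : ℕ} {p : ELine L × ELine L}
    (h : I.EndConsecutive e p) (he : e + 1 < I.m) : p.1 ≠ I.lastEndAbove (e + 1) := by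
  intro hp
  rcases h.of_lt he with h | h
  · exact (I.nodup_reds e).not_pair_infix_of_getLast? (by rw [hp]; exact I.getLast?_reds e) h
  · exact not_red_of_green (List.mem_left_of_pair_infix h) (hp ▸ I.lastEndAbove_mem e)

theorem EndConsecutive.snd_ne_lastEndBelow {e : ℕ} {p : ELine L × ELine L}
    (h : I.EndConsecutive e p) (he : e + 1 < I.m) : p.2 ≠ I.lastEndBelow (e + 1) := by
  intro hp
  rcases h.of_lt he with h | h
  · exact not_green_of_red (List.mem_right_of_pair_infix h) (hp ▸ I.lastEndBelow_mem e)
  · exact (I.nodup_greens e).not_pair_infix_of_head? (by rw [hp]; exact I.head?_greens e) h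

theorem GoodPair.lt_m {e : ℕ} {p : ELine L × ELine L} (h : I.GoodPair e p) : e < I.m := by
  cases h with
  | ending _ _ h _ => exact h
  | inherit _ _ q h _ =>
    have := h.black.elim Black.lt_m Black.lt_m
    omega

theorem GoodPair.cases_black {e : ℕ} {p : ELine L × ELine L} (h : I.GoodPair e p) :
    (I.EndConsecutive e p) ∨ ∃ q, I.Identified e p q ∧ I.GoodPair (e + 1) q := by
  cases h with
  | ending _ _ _ h => exact Or.inl h
  | inherit _ _ q h h' => exact Or.inr ⟨q, h, h'⟩

theorem GoodPair.exists_identified {e : ℕ} {p : ELine L × ELine L} (h : I.GoodPair e p)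
    (hb : I.Black e p.1 ∨ I.Black e p.2) : ∃ q, I.Identified e p q ∧ I.GoodPair (e + 1) q := by
  rcases h.cases_black with h | h
  · exact (hb.elim h.not_black.1 h.not_black.2).elim
  · exact h

/-- A line has at most one good lower partner on an edge. Ending pairs are read off a duplicate-free
clockwise order, inherited ones are determined by their unique continuation. The two kinds cannot
compete: before the last node, the upper line of an ending pair is neither black nor the last red
line. -/
theorem GoodPair.right_unique {e : ℕ} {a b c : ELine L} (h : I.GoodPair e (a, b))
    (h' : I.GoodPair e (a, c)) : b = c := by
  generalize hp : (a, b) = p at h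
  induction h generalizing a b c with
  | ending e p he h =>
    subst hp
    rcases h'.cases_black with h' | ⟨q, h', -⟩
    · exact (I.nodup_reds_append_greens e).pair_infix_right_unique h.infix h'.infix
    · have hm := h'.black.elim Black.lt_m Black.lt_m
      rcases h' with h' | h' | h'
      · exact (h.not_black.1 h'.1).elim
      · exact (h.fst_ne_lastEndAbove hm h'.2.1).elim
      · exact (h.not_black.1 h'.1).elim
  | inherit e p q h hq ih =>
    subst hp
    have hm := h.black.elim Black.lt_m Black.lt_m
    rcases h'.cases_black with h' | ⟨q', h', hq'⟩
    · rcases h with h | h | h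
      · exact (h'.not_black.1 h.1).elim
      · exact (h'.fst_ne_lastEndAbove hm h.2.1).elim
      · exact (h'.not_black.1 h.1).elim
    · have h1 := @not_black_firstStartAbove L _ I e
      have h2 := @not_black_firstStartBelow L _ I e
      have h3 := @not_black_lastEndAbove L _ I e
      rcases h with ⟨ha, hb, rfl⟩ | ⟨ha, hb, rfl⟩ | ⟨ha, hb, rfl⟩ <;>
      rcases h' with ⟨ha', hb', rfl⟩ | ⟨ha', hb', rfl⟩ | ⟨ha', hb', rfl⟩
      · exact ih hq' rfl
      · simp_all
      · have := ih hq' rfl; simp_all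
      · simp_all
      · exact ih hq' rfl
      · simp_all
      · have := ih hq' rfl; simp_all
      · simp_all
      · simp_all

theorem GoodPair.left_unique {e : ℕ} {a b c : ELine L} (h : I.GoodPair e (b, a))
    (h' : I.GoodPair e (c, a)) : b = c := by
  generalize hp : (b, a) = p at h
  induction h generalizing a b c with
  | ending e p he h =>
    subst hp
    rcases h'.cases_black with h' | ⟨q, h', -⟩
    · exact (I.nodup_reds_append_greens e).pair_infix_left_unique h.infix h'.infix
    · have hm := h'.black.elim Black.lt_m Black.lt_m
      rcases h' with h' | h' | h'
      · exact (h.not_black.2 h'.2.1).elim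
      · exact (h.not_black.2 h'.1).elim
      · exact (h.snd_ne_lastEndBelow hm h'.2.1).elim
  | inherit e p q h hq ih =>
    subst hp
    have hm := h.black.elim Black.lt_m Black.lt_m
    rcases h'.cases_black with h' | ⟨q', h', hq'⟩
    · rcases h with h | h | h
      · exact (h'.not_black.2 h.2.1).elim
      · exact (h'.not_black.2 h.1).elim
      · exact (h'.snd_ne_lastEndBelow hm h.2.1).elim
    · have h1 := @not_black_firstStartAbove L _ I e
      have h2 := @not_black_firstStartBelow L _ I e
      have h3 := @not_black_lastEndBelow L _ I e
      rcases h with ⟨ha, hb, rfl⟩ | ⟨ha, hb, rfl⟩ | ⟨ha, hb, rfl⟩ <;>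
      rcases h' with ⟨ha', hb', rfl⟩ | ⟨ha', hb', rfl⟩ | ⟨ha', hb', rfl⟩
      · exact ih hq' rfl
      · have := ih hq' rfl; simp_all
      · simp_all
      · have := ih hq' rfl; simp_all
      · simp_all
      · simp_all
      · simp_all
      · simp_all
      · exact ih hq' rfl

/-- Together with `GoodPair.snd_green` this makes the red lines a prefix and the green lines a
suffix of every good sequence. -/
theorem GoodPair.fst_red {e : ℕ} {a b : ELine L} (h : I.GoodPair e (a, b)) (hb : b ∈ I.reds e) :
    a ∈ I.reds e := by
  rcases h.cases_black with h | ⟨q, h, -⟩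
  · have := h.infix
    rw [List.pair_infix_iff_of_disjoint_right (not_green_of_red hb)] at this
    exact List.mem_left_of_pair_infix this
  · exact absurd hb h.snd_not_red

theorem GoodPair.snd_green {e : ℕ} {a b : ELine L} (h : I.GoodPair e (a, b))
    (ha : a ∈ I.greens e) : b ∈ I.greens e := by
  rcases h.cases_black with h | ⟨q, h, -⟩
  · have := h.infix
    rw [List.pair_infix_iff_of_disjoint_left (not_red_of_green ha)] at this
    exact List.mem_right_of_pair_infix this
  · exact absurd ha h.fst_not_green

theorem GoodPair.color_fst {e : ℕ} {a b : ELine L} (h : I.GoodPair e (a, b)) :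
    a ∈ I.reds e ∨ I.Black e a ∨ a ∈ I.greens e := by
  rcases h.cases_black with h | ⟨q, h, -⟩
  · have := List.mem_append.1 (List.mem_left_of_pair_infix h.infix); tauto
  · rcases h with h | h | h
    · exact Or.inr (Or.inl h.1)
    · exact Or.inl ((show a = _ from h.2.1) ▸ I.lastEndAbove_mem e)
    · exact Or.inr (Or.inl h.1)

/-- A good pair of a red line and a line that is not red contains a black line, unless the path
ends. -/
theorem GoodPair.black_snd {e : ℕ} {a b : ELine L} (h : I.GoodPair e (a, b)) (he : e + 1 < I.m)
    (ha : a ∈ I.reds e) (hb : b ∉ I.reds e) : I.Black e b ∧ a = I.lastEndAbove (e + 1) := by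
  rcases h.cases_black with h | ⟨q, h, -⟩
  · rcases h.of_lt he with h | h
    · exact absurd (List.mem_right_of_pair_infix h) hb
    · exact absurd (List.mem_left_of_pair_infix h) (not_green_of_red ha)
  · rcases h with h | h | h
    · exact absurd ha h.1.not_red
    · exact ⟨h.1, h.2.1⟩
    · exact absurd ha h.1.not_red

theorem goodPair_of_infix_reds {e : ℕ} {a b : ELine L} (he : e < I.m) (h : [a, b] <:+: I.reds e) :
    I.GoodPair e (a, b) := .ending _ _ he (Or.inl h)

theorem goodPair_of_infix_greens {e : ℕ} {a b : ELine L} (he : e < I.m)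
    (h : [a, b] <:+: I.greens e) : I.GoodPair e (a, b) := .ending _ _ he (Or.inr (Or.inl h))

/-! ### Linked pairs -/

theorem Linked.good_left {e f : ℕ} {p q : ELine L × ELine L} (h : I.Linked e p f q) :
    I.GoodPair e p := by
  induction h with
  | refl h => exact h
  | next _ _ _ _ _ _ ih => exact ih

theorem Linked.good_right {e f : ℕ} {p q : ELine L × ELine L} (h : I.Linked e p f q) :
    I.GoodPair f q := by
  cases h with
  | refl h => exact h
  | next _ _ _ _ _ h => exact h

theorem Linked.le {e f : ℕ} {p q : ELine L × ELine L} (h : I.Linked e p f q) : e ≤ f := by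
  induction h with
  | refl h => exact le_rfl
  | next _ _ _ _ _ _ ih => omega

theorem Linked.trans {e f g : ℕ} {p q r : ELine L × ELine L} (h : I.Linked e p f q)
    (h' : I.Linked f q g r) : I.Linked e p g r := by
  induction h' with
  | refl _ => exact h
  | next f q r _ h2 h3 ih => exact .next _ _ _ ih h2 h3

theorem Linked.single {e : ℕ} {p q : ELine L × ELine L} (h : I.Identified e p q)
    (hq : I.GoodPair (e + 1) q) : I.Linked e p (e + 1) q :=
  .next _ _ _ (.refl (.inherit _ _ _ h hq)) h hq

theorem Linked.eq_of_eq {e : ℕ} {p q : ELine L × ELine L} (h : I.Linked e p e q) : p = q := by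
  cases h with
  | refl _ => rfl
  | next f q r h _ _ => have := h.le; omega

theorem Linked.split {e f g : ℕ} {p r : ELine L × ELine L} (h : I.Linked e p g r) (h1 : e ≤ f)
    (h2 : f ≤ g) : ∃ q, I.Linked e p f q ∧ I.Linked f q g r := by
  induction h with
  | refl h =>
    obtain rfl : e = f := by omega
    exact ⟨p, .refl h, .refl h⟩
  | next g q r h hi hg ih =>
    rcases h2.lt_or_eq with h2 | rfl
    · obtain ⟨s, hs, hs'⟩ := ih (by omega)
      exact ⟨s, hs, .next _ _ _ hs' hi hg⟩
    · exact ⟨r, .next _ _ _ h hi hg, .refl hg⟩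

theorem Linked.right_unique {e f : ℕ} {p q q' : ELine L × ELine L} (h : I.Linked e p f q)
    (h' : I.Linked e p f q') : q = q' := by
  induction h generalizing q' with
  | refl h => exact h'.eq_of_eq
  | next f q r h hi hg ih =>
    cases h' with
    | refl _ => have := h.le; omega
    | next _ s _ h' hi' _ =>
      obtain rfl := ih h'
      exact hi.right_unique hi'

theorem Linked.left_unique {e f : ℕ} {p p' q : ELine L × ELine L} (h : I.Linked e p f q)
    (h' : I.Linked e p' f q) : p = p' := by
  induction h generalizing p' with
  | refl h => exact h'.eq_of_eq.symm
  | next f q r h hi hg ih =>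
    cases h' with
    | refl _ => have := h.le; omega
    | next _ s _ h' hi' _ =>
      obtain rfl := hi.left_unique hi'
      exact ih h'

theorem Linked.linked_of_le {e f g : ℕ} {p q r : ELine L × ELine L} (h : I.Linked e p f q)
    (h' : I.Linked e p g r) (hfg : f ≤ g) : I.Linked f q g r := by
  obtain ⟨s, hs, hs'⟩ := h'.split h.le hfg
  rwa [h.right_unique hs]

theorem Linked.exists_next {e g : ℕ} {p r : ELine L × ELine L} (h : I.Linked e p g r)
    (hg : e < g) : ∃ q, I.Identified e p q ∧ I.Linked (e + 1) q g r := by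
  obtain ⟨q, hq, hq'⟩ := h.split (f := e + 1) (by omega) (by omega)
  cases hq with
  | next _ s _ h hi _ =>
    obtain rfl := h.eq_of_eq
    exact ⟨q, hi, hq'⟩

theorem Linked.eq_of_endConsecutive {e f : ℕ} {p q : ELine L × ELine L} (h : I.Linked e p f q)
    (hp : I.EndConsecutive e p) : e = f ∧ p = q := by
  rcases h.le.lt_or_eq with h' | rfl
  · obtain ⟨_, hi, -⟩ := h.exists_next h'
    exact (hp.not_identified hi).elim
  · exact ⟨rfl, h.eq_of_eq⟩

/-- Identification is functional and stops at an ending pair, so each class has a single last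
member, which can represent it when counting. -/
theorem Linked.ending_unique {e f g : ℕ} {p q r : ELine L × ELine L} (h : I.Linked e p f q)
    (h' : I.Linked e p g r) (hq : I.EndConsecutive f q) (hr : I.EndConsecutive g r) :
    f = g ∧ q = r := by
  rcases le_total f g with hfg | hfg
  · exact (h.linked_of_le h' hfg).eq_of_endConsecutive hq
  · have := (h'.linked_of_le h hfg).eq_of_endConsecutive hr
    exact ⟨this.1.symm, this.2.symm⟩

theorem GoodPair.exists_ending {e : ℕ} {p : ELine L × ELine L} (h : I.GoodPair e p) :
    ∃ f q, f < I.m ∧ I.EndConsecutive f q ∧ I.Linked e p f q := by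
  induction h with
  | ending e p he h => exact ⟨e, p, he, h, .refl (.ending _ _ he h)⟩
  | inherit e p q h hq ih =>
    obtain ⟨f, r, hf, hr, hl⟩ := ih
    exact ⟨f, r, hf, hr, (Linked.single h hq).trans hl⟩

/-- The pair `p` on `e` is not identified with any pair on the preceding edge. -/
def IsRoot (I : PathNetwork L) (e : ℕ) (p : ELine L × ELine L) : Prop :=
  ∀ f q, e = f + 1 → ¬ I.Identified f q p

theorem GoodPair.exists_root {e : ℕ} {p : ELine L × ELine L} (h : I.GoodPair e p) :
    ∃ f q, I.IsRoot f q ∧ I.Linked f q e p := by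
  induction e generalizing p with
  | zero => exact ⟨0, p, fun f q hf => by omega, .refl h⟩
  | succ e ih =>
    by_cases hp : ∃ q, I.Identified e q p
    · obtain ⟨q, hq⟩ := hp
      obtain ⟨f, r, hr, hl⟩ := ih (.inherit _ _ _ hq h)
      exact ⟨f, r, hr, .next _ _ _ hl hq h⟩
    · refine ⟨e + 1, p, fun f q hf hq => ?_, .refl h⟩
      obtain rfl : e = f := by omega
      exact hp ⟨q, hq⟩

theorem Linked.eq_of_isRoot {e f : ℕ} {p q : ELine L × ELine L} (h : I.Linked e p f q)
    (hq : I.IsRoot f q) : e = f ∧ p = q := by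
  cases h with
  | refl _ => exact ⟨rfl, rfl⟩
  | next f r _ _ hi _ => exact (hq f r rfl hi).elim

/-- Identification is also injective, so a class has a single first member. -/
theorem Linked.root_unique {e f g : ℕ} {p q r : ELine L × ELine L} (h : I.Linked e p g r)
    (h' : I.Linked f q g r) (hp : I.IsRoot e p) (hq : I.IsRoot f q) : e = f ∧ p = q := by
  rcases le_total e f with hef | hef
  · obtain ⟨s, hs, hs'⟩ := h.split hef h'.le
    obtain rfl := hs'.left_unique h'
    exact hs.eq_of_isRoot hq
  · obtain ⟨s, hs, hs'⟩ := h'.split hef h.le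
    obtain rfl := hs'.left_unique h
    obtain ⟨rfl, rfl⟩ := hs.eq_of_isRoot hp
    exact ⟨rfl, rfl⟩

/-- An identified pair keeps a black line from the preceding edge, whereas both lines of an initial
pair start at the node or are virtual. -/
theorem InitialPair.isRoot {e : ℕ} {p : ELine L × ELine L} (h : I.InitialPair e p) :
    I.IsRoot e p := by
  rintro f q rfl hi
  have hm : ∀ x, x ∈ I.tops (f + 1) ++ I.bots (f + 1) → ¬ I.Black f x := fun x hx hb =>
    (List.mem_append.1 hx).elim hb.not_starts.1 hb.not_starts.2
  have hp : [p.1, p.2] <:+: I.tops (f + 1) ++ I.bots (f + 1) := by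
    rcases h.2 with h | h | h
    · exact List.IsInfix.trans h List.infix_append_left
    · exact List.IsInfix.trans h List.infix_append_right
    · exact h.2
  have h1 := hm _ (List.mem_left_of_pair_infix hp)
  have h2 := hm _ (List.mem_right_of_pair_infix hp)
  rcases hi with ⟨ha, hb, rfl⟩ | ⟨ha, hb, rfl⟩ | ⟨ha, hb, rfl⟩
  · exact h1 ha
  · exact h2 ha
  · exact h1 ha

/-! ### Line orders -/

/-- `π` is an order of `L_e`. -/
def IsOrder (I : PathNetwork L) (e : ℕ) (π : List L) : Prop :=
  π.Nodup ∧ ∀ l, l ∈ π ↔ I.On e l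

theorem black_line {e : ℕ} {l : L} : I.Black e (line l) ↔ I.On e l ∧ I.On (e + 1) l := by
  simp [Black]

theorem red_or_green_line {e : ℕ} {l : L} :
    line l ∈ I.reds e ∨ line l ∈ I.greens e ↔ I.On e l ∧ ¬ I.On (e + 1) l := by
  have := (I.endsAbove_endsBelow (e + 1)).2 l
  rw [List.mem_append] at this
  simp only [reds, greens, List.mem_cons, reduceCtorEq, List.mem_map, line.injEq, exists_eq_right,
    false_or, List.mem_append, List.not_mem_nil, or_false, this]
  have := I.first_le_last l
  omega

theorem IsOrder.mem_ext {e : ℕ} {π : List L} (h : I.IsOrder e π) {x : ELine L} :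
    x ∈ ext π ↔ x ∈ I.reds e ∨ I.Black e x ∨ x ∈ I.greens e := by
  rcases x with _ | l | _
  · simp [ELine.mem_ext, reds]
  · have h1 := @red_or_green_line L _ I e l
    have h2 := @black_line L _ I e l
    simp only [ELine.mem_ext, reduceCtorEq, false_or, line.injEq, exists_eq_right', h.2]
    tauto
  · simp [ELine.mem_ext, greens]

theorem IsOrder.nodup_ext {e : ℕ} {π : List L} (h : I.IsOrder e π) : (ext π).Nodup :=
  ELine.nodup_ext.2 h.1

theorem IsOrder.of_perm {e : ℕ} {π π' : List L} (h : I.IsOrder e π) (h' : π'.Perm π) :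
    I.IsOrder e π' :=
  ⟨h'.nodup_iff.2 h.1, fun l => by rw [h'.mem_iff, h.2]⟩

theorem isOrder_leftOrder_zero (S : LineOrders L) : I.IsOrder 0 (I.leftOrder S 0) := by
  obtain ⟨h1, h2⟩ := I.startsAbove_startsBelow 0
  have hp : (I.leftOrder S 0).Perm (I.startsAbove 0 ++ I.startsBelow 0) := by
    simpa [leftOrder] using (List.reverse_perm _).append (List.reverse_perm _)
  refine ⟨hp.nodup_iff.2 h1, fun l => ?_⟩
  rw [hp.mem_iff, h2]
  simp

theorem isOrder_leftOrder_succ {S : LineOrders L} {e : ℕ} (h : I.IsOrder e (S.π e (S.t e))) :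
    I.IsOrder (e + 1) (I.leftOrder S (e + 1)) := by
  obtain ⟨h1, h2⟩ := I.startsAbove_startsBelow (e + 1)
  have hp : (I.leftOrder S (e + 1)).Perm ((I.startsAbove (e + 1) ++ I.startsBelow (e + 1)) ++
      (S.π e (S.t e)).filter (fun l => I.On (e + 1) l)) := by
    simp only [leftOrder, Nat.succ_pos, if_true, Nat.add_sub_cancel, List.append_assoc]
    refine (List.reverse_perm _).append (List.perm_append_comm.trans ?_)
    exact (List.reverse_perm _).append (List.Perm.refl _)
  constructor
  · rw [hp.nodup_iff, List.nodup_append]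
    refine ⟨h1, h.1.filter _, ?_⟩
    rintro l hl _ hl' rfl
    rw [h2] at hl
    have := (h.2 l).1 (List.mem_of_mem_filter hl')
    omega
  · intro l
    rw [hp.mem_iff, List.mem_append, h2]
    simp only [List.mem_filter, h.2, decide_eq_true_eq]
    omega

theorem filter_leftOrder {S : LineOrders L} {e : ℕ} (h : I.IsOrder e (S.π e (S.t e))) :
    (I.leftOrder S (e + 1)).filter (fun l => I.On e l) =
      (S.π e (S.t e)).filter (fun l => I.On (e + 1) l) := by
  rw [leftOrder]
  simp only [Nat.succ_pos, if_true, Nat.add_sub_cancel, List.filter_append, List.filter_filter]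
  have hs : ∀ l, l ∈ I.startsAbove (e + 1) ++ I.startsBelow (e + 1) → ¬ I.On e l := by
    intro l hl
    rw [(I.startsAbove_startsBelow (e + 1)).2] at hl
    omega
  have h1 : (I.startsAbove (e + 1)).reverse.filter (fun l => I.On e l) = [] :=
    List.filter_eq_nil_iff.2 fun l hl => by simpa using hs l (by simp_all)
  have h2 : (I.startsBelow (e + 1)).reverse.filter (fun l => I.On e l) = [] :=
    List.filter_eq_nil_iff.2 fun l hl => by simpa using hs l (by simp_all)
  rw [h1, h2, List.append_nil, List.nil_append]
  refine List.filter_congr fun l hl => ?_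
  have := (h.2 l).1 hl
  simp [this]

theorem Feasible.isOrder {S : LineOrders L} (h : I.Feasible S) {e i : ℕ} (he : e < I.m)
    (hi : i ≤ S.t e) : I.IsOrder e (S.π e i) := h.orders e he i hi

/-- The two consistency conditions at a node force the continuing lines to keep one common order
`mid`; only what surrounds it changes, from ending lines to starting lines. -/
theorem Feasible.exists_mid {S : LineOrders L} (h : I.Feasible S) {e : ℕ} (he : e + 1 < I.m) :
    ∃ mid, (∀ x, x ∈ mid ↔ I.Black e x) ∧
      ext (S.π e (S.t e)) = I.reds e ++ (mid ++ I.greens e) ∧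
      ext (S.π (e + 1) 0) = I.tops (e + 1) ++ (mid ++ I.bots (e + 1)) := by
  have ho := h.isOrder (e := e) (by omega) le_rfl
  have hr := h.consistent_right e (by omega)
  have hl := h.consistent_left (e + 1) he
  have key : (S.π (e + 1) 0).filter (fun l => I.On e l) =
      (S.π e (S.t e)).filter (fun l => I.On (e + 1) l) := by
    rw [hl, filter_leftOrder ho]
  refine ⟨((S.π e (S.t e)).filter (fun l => I.On (e + 1) l)).map line, fun x => ?_, ?_, ?_⟩
  · simp only [List.mem_map, List.mem_filter, ho.2, decide_eq_true_eq, Black]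
    exact ⟨fun ⟨l, hl, e⟩ => ⟨l, e.symm, hl⟩, fun ⟨l, e, hl⟩ => ⟨l, hl, e.symm⟩⟩
  · rw [congrArg ext hr, rightOrder, if_pos he, key]
    simp [ext, reds, greens]
  · rw [congrArg ext hl, leftOrder, if_pos (Nat.succ_pos _)]
    simp [ext, tops, bots]

theorem Feasible.ext_last {S : LineOrders L} (h : I.Feasible S) {e : ℕ} (he : e + 1 = I.m) :
    ext (S.π e (S.t e)) = I.reds e ++ I.greens e := by
  rw [h.consistent_right e (by omega), rightOrder, if_neg (by omega)]
  simp [ext, reds, greens]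

theorem Feasible.ext_zero {S : LineOrders L} (h : I.Feasible S) (he : 0 < I.m) :
    ext (S.π 0 0) = I.tops 0 ++ I.bots 0 := by
  rw [h.consistent_left 0 he, leftOrder, if_neg (lt_irrefl 0)]
  simp [ext, tops, bots]

/-- This justifies identification: the last red line and, after the node, the first line starting
above both lie directly on top of `mid`, so a black line is next to the one if and only if it is
next to the other. The same holds below. -/
theorem Feasible.together_next {S : LineOrders L} (h : I.Feasible S) {e : ℕ}
    {p q : ELine L × ELine L} (hpq : I.Identified e p q) :
    Together (S.π e (S.t e)) p ↔ Together (S.π (e + 1) 0) q := by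
  obtain ⟨mid, hm, h1, h2⟩ := h.exists_mid (hpq.black.elim Black.lt_m Black.lt_m)
  simp only [Together, h1, h2]
  rcases hpq with ⟨ha, hb, rfl⟩ | ⟨ha, hb, rfl⟩ | ⟨ha, hb, rfl⟩
  · rw [List.pair_infix_iff_of_disjoint_left ha.not_red,
      List.pair_infix_iff_of_disjoint_right hb.not_green,
      List.pair_infix_iff_of_disjoint_left ha.not_starts.1,
      List.pair_infix_iff_of_disjoint_right hb.not_starts.2]
  · simp only [← List.append_assoc]
    rw [List.pair_infix_iff_of_disjoint_right ha.not_green,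
      List.pair_infix_iff_of_disjoint_right ha.not_starts.2, List.pair_infix_append,
      List.pair_infix_append, I.getLast?_reds, I.getLast?_tops, hb]
    have h1 : I.lastEndAbove (e + 1) ∉ mid := fun h => not_black_lastEndAbove ((hm _).1 h)
    have h2 : I.firstStartAbove (e + 1) ∉ mid := fun h => not_black_firstStartAbove ((hm _).1 h)
    have h3 := fun h => ha.not_red (List.mem_right_of_pair_infix (x := I.lastEndAbove (e + 1)) h)
    have h4 := fun h => ha.not_starts.1
      (List.mem_right_of_pair_infix (x := I.firstStartAbove (e + 1)) h)
    have h5 := fun h => h1 (List.mem_left_of_pair_infix (y := p.2) h)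
    have h6 := fun h => h2 (List.mem_left_of_pair_infix (y := p.2) h)
    tauto
  · rw [List.pair_infix_iff_of_disjoint_left ha.not_red,
      List.pair_infix_iff_of_disjoint_left ha.not_starts.1, List.pair_infix_append,
      List.pair_infix_append, I.head?_greens, I.head?_bots, hb]
    have h1 : I.lastEndBelow (e + 1) ∉ mid := fun h => not_black_lastEndBelow ((hm _).1 h)
    have h2 : I.firstStartBelow (e + 1) ∉ mid := fun h => not_black_firstStartBelow ((hm _).1 h)
    have h3 := fun h => ha.not_green (List.mem_left_of_pair_infix (y := I.lastEndBelow (e + 1)) h)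
    have h4 := fun h => ha.not_starts.2
      (List.mem_left_of_pair_infix (y := I.firstStartBelow (e + 1)) h)
    have h5 := fun h => h1 (List.mem_right_of_pair_infix (x := p.1) h)
    have h6 := fun h => h2 (List.mem_right_of_pair_infix (x := p.1) h)
    tauto

theorem Feasible.together_ending {S : LineOrders L} (h : I.Feasible S) {e : ℕ} (he : e < I.m)
    {p : ELine L × ELine L} (hp : I.EndConsecutive e p) : Together (S.π e (S.t e)) p := by
  rcases (show e + 1 ≤ I.m from he).lt_or_eq with he | he
  · obtain ⟨mid, -, h1, -⟩ := h.exists_mid he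
    rw [Together, h1]
    rcases hp.of_lt he with hp | hp
    · exact hp.trans List.infix_append_left
    · exact hp.trans (List.infix_append_right.trans List.infix_append_right)
  · rw [Together, h.ext_last he]
    exact hp.infix

theorem InitialPair.together {S : LineOrders L} (h : I.Feasible S) {e : ℕ}
    {p : ELine L × ELine L} (hp : I.InitialPair e p) : Together (S.π e 0) p := by
  have he := hp.1.lt_m
  have key : ∃ mid, (∀ x ∈ mid, ∃ l, x = line l ∧ I.On e l ∧ I.first l ≠ e) ∧
      ext (S.π e 0) = I.tops e ++ (mid ++ I.bots e) := by
    cases e with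
    | zero => exact ⟨[], by simp, by simpa using h.ext_zero he⟩
    | succ e =>
      obtain ⟨mid, hm, -, h2⟩ := h.exists_mid he
      refine ⟨mid, fun x hx => ?_, h2⟩
      obtain ⟨l, rfl, hl, hl'⟩ := (hm x).1 hx
      exact ⟨l, rfl, hl', by omega⟩
  obtain ⟨mid, hm, h1⟩ := key
  rw [Together, h1]
  rcases hp.2 with hp | hp | hp
  · exact List.IsInfix.trans hp List.infix_append_left
  · exact List.IsInfix.trans hp (List.infix_append_right.trans List.infix_append_right)
  · obtain rfl : mid = [] := by
      refine List.eq_nil_iff_forall_not_mem.2 fun x hx => ?_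
      obtain ⟨l, -, hl, hl'⟩ := hm x hx
      exact hl' (hp.1 l hl)
    exact hp.2

/-- At the left end the order is `tops`, `mid`, `bots`. An adjacency that involves `mid` is
inherited from the preceding edge, which a root forbids; the others are initial, the junction of
`tops` and `bots` occurring only for empty `mid`. -/
theorem Feasible.initialPair {S : LineOrders L} (h : I.Feasible S) {e : ℕ}
    {p : ELine L × ELine L} (hp : I.GoodPair e p) (hr : I.IsRoot e p)
    (ht : Together (S.π e 0) p) : I.InitialPair e p := by
  have he := hp.lt_m
  refine ⟨hp, ?_⟩
  rw [Together] at ht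
  cases e with
  | zero =>
    rw [h.ext_zero he] at ht
    exact Or.inr (Or.inr ⟨fun l hl => by omega, ht⟩)
  | succ e =>
    obtain ⟨mid, hm, h1, h2⟩ := h.exists_mid he
    rw [h2] at ht
    rcases List.pair_infix_append.1 ht with ht | ht | ht
    · exact Or.inl ht
    · rcases List.pair_infix_append.1 ht with ht | ht | ht
      · exact (hr e p rfl (Or.inl ⟨(hm _).1 (List.mem_left_of_pair_infix ht),
          (hm _).1 (List.mem_right_of_pair_infix ht), rfl⟩)).elim
      · exact Or.inr (Or.inl ht)
      · rw [I.head?_bots] at ht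
        obtain ⟨p1, p2⟩ := p
        refine (hr e (p1, I.lastEndBelow (e + 1)) rfl (Or.inr (Or.inr
          ⟨(hm _).1 (List.mem_of_getLast? ht.1), rfl, ?_⟩))).elim
        simpa using ht.2.symm
    · rw [I.getLast?_tops] at ht
      rcases mid with _ | ⟨x, mid⟩
      · refine Or.inr (Or.inr ⟨fun l hl => ?_, ?_⟩)
        · by_contra hne
          have := (hm (line l)).2 (black_line.2 ⟨by omega, hl⟩)
          simp at this
        · refine List.pair_infix_append.2 (Or.inr (Or.inr ?_))
          rw [← ht.1]
          exact ⟨I.getLast?_tops _, ht.2⟩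
      · obtain ⟨p1, p2⟩ := p
        obtain rfl : x = p2 := by simpa using ht.2
        refine (hr e (I.lastEndAbove (e + 1), x) rfl (Or.inr (Or.inl
          ⟨(hm _).1 (by simp), rfl, ?_⟩))).elim
        simpa using ht.1.symm

/-! ### The history of a pair -/

/-- Induction over time along one class of identified pairs. The predicate takes the edge and the
pair as arguments because the pair may change its lines from edge to edge. -/
theorem Linked.timeline {S : LineOrders L} {P : ℕ → ELine L × ELine L → ℕ → Prop} {e i : ℕ}
    {p : ELine L × ELine L} (hi : i ≤ S.t e) (start : P e p i)
    (step : ∀ f q j, I.Linked e p f q → j < S.t f → (e < f ∨ i ≤ j) → P f q j → P f q (j + 1))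
    (next : ∀ f q r, I.Identified f q r → I.Linked e p f q → I.Linked e p (f + 1) r →
      P f q (S.t f) → P (f + 1) r 0)
    {f : ℕ} {q : ELine L × ELine L} (h : I.Linked e p f q) {j : ℕ} (hj : j ≤ S.t f)
    (hj' : e < f ∨ i ≤ j) : P f q j := by
  induction h generalizing j with
  | refl h =>
    have hj' : i ≤ j := by omega
    induction j, hj' using Nat.le_induction with
    | base => exact start
    | succ j hij ih => exact step e p j (.refl h) hj (Or.inr hij) (ih (by omega) (Or.inr hij))
  | next f q r h hqr hr ih =>
    have hl := Linked.next _ _ _ h hqr hr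
    have hlt := h.le
    induction j with
    | zero =>
      refine next _ _ _ hqr h hl (ih le_rfl ?_)
      rcases hlt.lt_or_eq with h | rfl
      · exact Or.inl h
      · exact Or.inr hi
    | succ j ihj =>
      exact step _ _ _ hl hj (Or.inl (by omega)) (ihj (by omega) (Or.inl (by omega)))

theorem Created.mono {S : LineOrders L} {e i i' : ℕ} {p : ELine L × ELine L}
    (h : I.Created S e i p) (hi : i ≤ i') : I.Created S e i' p := by
  obtain ⟨f, q, j, hl, hj, hc⟩ := h
  exact ⟨f, q, j, hl, by omega, hc⟩

theorem Created.next {S : LineOrders L} {e : ℕ} {p q : ELine L × ELine L}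
    (h : I.Created S e (S.t e) p) (hpq : I.Identified e p q) (hq : I.GoodPair (e + 1) q) :
    I.Created S (e + 1) 0 q := by
  obtain ⟨g, r, j, hl, hj, hc⟩ := h
  refine ⟨g, r, j, hl.trans (.single hpq hq), Or.inl ?_, hc⟩
  rcases hj with hj | ⟨rfl, hj⟩
  · exact ⟨by omega, hj.2⟩
  · exact ⟨by omega, hj⟩

/-- A pair that was not present at some time and is present later has been created. -/
theorem Feasible.created {S : LineOrders L} (h : I.Feasible S) {e f i j : ℕ}
    {p q : ELine L × ELine L} (hl : I.Linked f q e p) (hq : ¬ Together (S.π f j) q)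
    (hj : j ≤ S.t f) (hji : f < e ∨ j ≤ i) (hi : i ≤ S.t e) (hp : Together (S.π e i) p) :
    I.Created S e i p := by
  refine Linked.timeline (P := fun e p i => Together (S.π e i) p → I.Created S e i p) hj
    (fun h => (hq h).elim) ?_ ?_ hl hi hji hp
  · intro g r k hl hk _ ih ht
    by_cases h' : Together (S.π g k) r
    · exact (ih h').mono (Nat.le_succ k)
    · exact ⟨g, r, k, .refl hl.good_right, Or.inr ⟨rfl, Nat.lt_succ_self k⟩, h', ht⟩
  · intro g r s hrs _ hl ih ht
    exact (ih ((h.together_next hrs).2 ht)).next hrs hl.good_right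

/-- An initial pair that is never broken is always present. -/
theorem Feasible.together_of_not_broken {S : LineOrders L} (h : I.Feasible S) {e f : ℕ}
    {p q : ELine L × ELine L} (hp : I.InitialPair e p) (hb : (e, p) ∉ I.brokenInitial S)
    (hl : I.Linked e p f q) {j : ℕ} (hj : j ≤ S.t f) : Together (S.π f j) q := by
  refine Linked.timeline (P := fun e p i => Together (S.π e i) p) (i := 0) (Nat.zero_le _)
    (hp.together h) ?_ ?_ hl hj (Or.inr (Nat.zero_le _))
  · intro g r k hl hk _ ih
    by_contra ht
    exact hb ⟨hp, g, r, k, hl, hk, ih, ht⟩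
  · intro g r s hrs _ _ ih
    exact (h.together_next hrs).1 ih

theorem Feasible.initial_or_created {S : LineOrders L} (h : I.Feasible S) {e i : ℕ}
    {p : ELine L × ELine L} (hp : I.GoodPair e p) (hi : i ≤ S.t e) (ht : Together (S.π e i) p)
    (hc : ¬ I.Created S e i p) : ∃ f q, I.InitialPair f q ∧ I.Linked f q e p := by
  obtain ⟨f, q, hr, hl⟩ := hp.exists_root
  refine ⟨f, q, h.initialPair hl.good_left hr ?_, hl⟩
  by_contra hq
  exact hc (h.created hl hq (Nat.zero_le _) (Or.inr (Nat.zero_le _)) hi ht)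

/-- An initial pair is broken for the first time at some point. -/
theorem Feasible.exists_first_break {S : LineOrders L} (h : I.Feasible S) {e : ℕ}
    {p : ELine L × ELine L} (hb : (e, p) ∈ I.brokenInitial S) :
    ∃ f q j, I.Linked e p f q ∧ j < S.t f ∧ Together (S.π f j) q ∧ ¬ Together (S.π f (j + 1)) q ∧
      ¬ I.Created S f j q := by
  obtain ⟨hp, f, q, j, hl, hj, ht, ht'⟩ := hb
  by_contra hall
  push Not at hall
  -- Suppose every break is preceded by a creation. Then "present and never created" is invariant: a
  -- break would need an earlier creation, and a step that keeps the pair present creates nothing.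
  -- This contradicts the given break.
  have key := Linked.timeline (S := S)
    (P := fun e p i => Together (S.π e i) p ∧ ¬ I.Created S e i p) (e := e) (p := p) (i := 0)
    (Nat.zero_le _) ⟨hp.together h, ?_⟩ ?_ ?_ hl hj.le (Or.inr (Nat.zero_le _))
  · exact key.2 (hall f q j hl hj ht ht')
  · rintro ⟨g, r, k, hl, hk, -⟩
    have := (hl.eq_of_isRoot hp.isRoot).1
    omega
  · rintro g r k hl hk - ⟨ih, ih'⟩
    have htk : Together (S.π g (k + 1)) r := by
      by_contra h'
      exact ih' (hall g r k hl hk ih h')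
    refine ⟨htk, ?_⟩
    rintro ⟨g', r', k', hl', hk', hc, hc'⟩
    by_cases hlast : g' = g ∧ k' = k
    · obtain ⟨rfl, rfl⟩ := hlast
      obtain rfl := hl'.eq_of_eq
      exact hc ih
    · refine ih' ⟨g', r', k', hl', ?_, hc, hc'⟩
      rcases hk' with hk' | ⟨rfl, hk'⟩
      · exact Or.inl hk'
      · exact Or.inr ⟨rfl, by omega⟩
  · rintro g r s hrs hl hl' ⟨ih, ih'⟩
    refine ⟨(h.together_next hrs).1 ih, ?_⟩
    rintro ⟨g', r', k', hl'', hk', hc⟩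
    have hg : g' ≤ g := by omega
    obtain ⟨w, hw, hw'⟩ := hl''.split hg (Nat.le_succ g)
    obtain rfl : w = r := by
      obtain ⟨u, hu, hu'⟩ := hw'.exists_next (Nat.lt_succ_self g)
      rw [hu'.eq_of_eq] at hu
      exact hu.left_unique hrs
    refine ih' ⟨g', r', k', hw, ?_, hc⟩
    have hk : k' < S.t g' := hk'.elim And.right fun h => by omega
    rcases hg.lt_or_eq with hg | rfl
    · exact Or.inl ⟨hg, hk⟩
    · exact Or.inr ⟨rfl, hk⟩

end PathNetwork

/-! ### Block moves in the presence of the virtual lines. -/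

namespace ELine

theorem ext_append₄ {L : Type*} (A B C D : List L) :
    ext (A ++ B ++ C ++ D) =
      (top :: A.map line) ++ B.map line ++ C.map line ++ (D.map line ++ [bot]) := by
  simp [ext]

/-- Nonempty outer blocks absorb both virtual lines, so the two inner blocks consist of lines of the
instance. -/
theorem ext_eq_append₄ {L : Type*} {π : List L} {A B C D : List (ELine L)}
    (h : ext π = A ++ B ++ C ++ D) (hA : A ≠ []) (hD : D ≠ []) :
    ∃ a b c d, π = a ++ b ++ c ++ d ∧ A = top :: a.map line ∧ B = b.map line ∧ C = c.map line ∧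
      D = d.map line ++ [bot] := by
  obtain ⟨x, A, rfl⟩ := List.exists_cons_of_ne_nil hA
  obtain ⟨D, y, rfl⟩ := (List.eq_nil_or_concat' D).resolve_left hD
  simp only [ext, List.cons_append, List.cons.injEq] at h
  obtain ⟨rfl, h⟩ := h
  obtain ⟨h1, h'⟩ := List.append_inj' (h.trans (List.append_assoc _ _ _).symm) rfl
  obtain rfl : bot = y := by simpa using h'
  obtain ⟨l, d, rfl, h2, rfl⟩ := List.map_eq_append_iff.1 h1
  obtain ⟨l, c, rfl, h3, rfl⟩ := List.map_eq_append_iff.1 h2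
  obtain ⟨a, b, rfl, rfl, rfl⟩ := List.map_eq_append_iff.1 h3
  exact ⟨a, b, c, d, by simp, rfl, rfl, rfl, rfl⟩

theorem finite_setOf_lt {L : Type*} [Finite L] (m : ℕ) : {y : ℕ × ELine L × ELine L | y.1 < m}.Finite := by
  refine ((Set.finite_Iio m).prod (Set.finite_univ (α := ELine L × ELine L))).subset ?_
  intro y hy
  exact ⟨hy, trivial⟩

end ELine

open ELine in
/-- A block move creates at most three pairs. -/
theorem BlockMove.exists_created {L : Type*} {π π' : List L} (h : BlockMove π π') :
    ∃ g : Fin 3 → ELine L × ELine L, ∀ p, Together π' p → ¬ Together π p → ∃ k, p = g k := by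
  obtain ⟨A, B, C, D, hB, hC, rfl, rfl⟩ := h
  -- The new adjacencies are the junctions `A|C`, `C|B` and `B|D`. The defaults of `getD` do not
  -- matter, because a pair found at a junction provides both entries.
  refine ⟨![(((top :: A.map line).getLast?).getD top, ((C.map line).head?).getD top),
    (((C.map line).getLast?).getD top, ((B.map line).head?).getD top),
    (((B.map line).getLast?).getD top, ((D.map line ++ [bot]).head?).getD top)], ?_⟩
  rintro ⟨x, y⟩ h h'
  rw [Together, ext_append₄] at h h'
  rcases List.pair_infix_swap h (by simpa using hC) (by simpa using hB) with h | h | h | h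
  · exact (h' h).elim
  · exact ⟨0, by simp only [Matrix.cons_val_zero, h.1, h.2, Option.getD_some]⟩
  · exact ⟨1, by simp only [Matrix.cons_val_one, Matrix.cons_val_zero, h.1, h.2, Option.getD_some]⟩
  · exact ⟨2, by simp only [Matrix.cons_val, h.1, h.2, Option.getD_some]⟩

namespace PathNetwork

open ELine

variable {L : Type*} [DecidableEq L] {I : PathNetwork L}

/-! ### Counting created pairs -/

/-- The good pairs, represented by their last edge, that are created by some block crossing. -/
def createdEnding (I : PathNetwork L) (S : LineOrders L) : Set (ℕ × ELine L × ELine L) :=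
  {y | y.1 < I.m ∧ I.EndConsecutive y.1 y.2 ∧ I.Created S y.1 (S.t y.1) y.2}

/-- The good pairs, represented by their last edge, that are not initial. -/
def nonInitialEnding (I : PathNetwork L) : Set (ℕ × ELine L × ELine L) :=
  {y | y.1 < I.m ∧ I.EndConsecutive y.1 y.2 ∧ ∀ e p, I.InitialPair e p → ¬ I.Linked e p y.1 y.2}

theorem finite_createdEnding [Finite L] (S : LineOrders L) : (I.createdEnding S).Finite :=
  (ELine.finite_setOf_lt I.m).subset fun _ h => h.1

theorem finite_nonInitialEnding [Finite L] : I.nonInitialEnding.Finite :=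
  (ELine.finite_setOf_lt I.m).subset fun _ h => h.1

theorem finite_brokenInitial [Finite L] (S : LineOrders L) : (I.brokenInitial S).Finite :=
  (ELine.finite_setOf_lt I.m).subset fun _ h => h.1.1.lt_m

/-- Each created class arises at one of the three junctions of some move. Sending a move and a
junction to the last pair of the class therefore covers all created classes. -/
theorem Feasible.ncard_createdEnding_le {S : LineOrders L} (h : I.Feasible S) :
    (I.createdEnding S).ncard ≤ 3 * I.cost S := by
  classical
  have : Nonempty (ELine L × ELine L) := ⟨(top, top)⟩
  choose! g hg using fun e he i hi => (h.moves e he i hi).exists_created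
  -- The value `x` is a dummy for junctions that are not good pairs.
  let ending : ℕ × ELine L × ELine L → ℕ × ELine L × ELine L := fun x =>
    if hx : ∃ y : ℕ × ELine L × ELine L, I.EndConsecutive y.1 y.2 ∧ I.Linked x.1 x.2 y.1 y.2
    then hx.choose else x
  let T := ((Finset.range I.m).sigma fun e => Finset.range (S.t e)) ×ˢ (Finset.univ : Finset (Fin 3))
  let F : (Σ _ : ℕ, ℕ) × Fin 3 → ℕ × ELine L × ELine L := fun x =>
    ending (x.1.1, g x.1.1 x.1.2 x.2)
  have hT : T.card = 3 * I.cost S := by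
    simp [T, cost, mul_comm]
  have hsub : I.createdEnding S ⊆ (T.image F : Finset _) := by
    rintro ⟨e, p⟩ ⟨he, hp, f, q, j, hl, hj, hc, hc'⟩
    have hf : f < I.m := hl.good_left.lt_m
    have hj : j < S.t f := by
      rcases hj with hj | ⟨rfl, hj⟩
      · exact hj.2
      · exact hj
    obtain ⟨k, hk⟩ := hg f hf j hj q hc' hc
    simp only [Finset.coe_image, Set.mem_image, Finset.mem_coe]
    refine ⟨(⟨f, j⟩, k), by simp [T, hf, hj], ?_⟩
    have hx : ∃ y : ℕ × ELine L × ELine L, I.EndConsecutive y.1 y.2 ∧ I.Linked f q y.1 y.2 :=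
      ⟨(e, p), hp, hl⟩
    simp only [F, ← hk, ending, dif_pos hx]
    obtain ⟨h1, h2⟩ := hx.choose_spec
    obtain ⟨h3, h4⟩ := h2.ending_unique hl h1 hp
    exact Prod.ext h3 h4
  calc (I.createdEnding S).ncard ≤ (T.image F : Set _).ncard :=
        Set.ncard_le_ncard hsub (Finset.finite_toSet _)
    _ = (T.image F).card := Set.ncard_coe_finset _
    _ ≤ T.card := Finset.card_image_le
    _ = 3 * I.cost S := hT

/-- Every good pair is represented by its last edge. -/
theorem exists_ending_map (I : PathNetwork L) : ∃ E : ℕ × ELine L × ELine L → ℕ × ELine L × ELine L,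
    ∀ x, I.GoodPair x.1 x.2 →
      (E x).1 < I.m ∧ I.EndConsecutive (E x).1 (E x).2 ∧ I.Linked x.1 x.2 (E x).1 (E x).2 := by
  have : ∀ x : ℕ × ELine L × ELine L, ∃ y : ℕ × ELine L × ELine L, I.GoodPair x.1 x.2 →
      y.1 < I.m ∧ I.EndConsecutive y.1 y.2 ∧ I.Linked x.1 x.2 y.1 y.2 := by
    intro x
    by_cases hx : I.GoodPair x.1 x.2
    · obtain ⟨f, q, h⟩ := hx.exists_ending
      exact ⟨(f, q), fun _ => h⟩
    · exact ⟨x, fun h => (hx h).elim⟩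
  choose E hE using this
  exact ⟨E, hE⟩

/-- An initial pair is present at first, so a creation presupposes an absence and thus a break. It
is also present at its end, so after a break it must be created again. -/
theorem Feasible.created_iff_broken {S : LineOrders L} (h : I.Feasible S) {e f : ℕ}
    {p q : ELine L × ELine L} (hp : I.InitialPair e p) (hl : I.Linked e p f q) (hf : f < I.m)
    (hq : I.EndConsecutive f q) : I.Created S f (S.t f) q ↔ (e, p) ∈ I.brokenInitial S := by
  constructor
  · rintro ⟨g, r, j, hl', hj, hc, -⟩
    by_contra hb
    -- A creation cannot precede the edge of the root, since the root is the first member of its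
    -- class.
    have hle : e ≤ g := by
      by_contra hlt
      obtain ⟨s, hs, hs'⟩ := hl'.split (f := e) (by omega) hl.le
      obtain rfl := hs'.left_unique hl
      have := (hs.eq_of_isRoot hp.isRoot).1
      omega
    obtain ⟨s, hs, hs'⟩ := hl.split hle hl'.le
    obtain rfl := hs'.left_unique hl'
    have hj : j < S.t g := by
      rcases hj with hj | ⟨rfl, hj⟩
      · exact hj.2
      · exact hj
    exact hc (h.together_of_not_broken hp hb hs hj.le)
  · rintro ⟨-, g, r, j, hl', hj, -, hc⟩
    have hgf : g ≤ f := by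
      by_contra hlt
      have := (hl.linked_of_le hl' (by omega)).eq_of_endConsecutive hq
      omega
    refine h.created (hl'.linked_of_le hl hgf) hc hj ?_ le_rfl (h.together_ending hf hq)
    rcases hgf.lt_or_eq with h | rfl
    · exact Or.inl h
    · exact Or.inr hj

/-- Only the second summand depends on the solution, so comparing created classes of two solutions
amounts to comparing their broken initial pairs. -/
theorem Feasible.ncard_createdEnding [Finite L] {S : LineOrders L} (h : I.Feasible S) :
    (I.createdEnding S).ncard = I.nonInitialEnding.ncard + (I.brokenInitial S).ncard := by
  obtain ⟨E, hE⟩ := I.exists_ending_map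
  have hinj : Set.InjOn E (I.brokenInitial S) := by
    rintro x hx y hy hxy
    have h1 := (hE x hx.1.1).2.2
    have h2 := (hE y hy.1.1).2.2
    rw [← hxy] at h2
    obtain ⟨h3, h4⟩ := h1.root_unique h2 hx.1.isRoot hy.1.isRoot
    exact Prod.ext h3 h4
  have heq : I.createdEnding S = I.nonInitialEnding ∪ E '' I.brokenInitial S := by
    ext ⟨f, q⟩
    constructor
    · rintro ⟨hf, hq, hc⟩
      by_cases hn : ∀ e p, I.InitialPair e p → ¬ I.Linked e p f q
      · exact Or.inl ⟨hf, hq, hn⟩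
      · push Not at hn
        obtain ⟨e, p, hp, hl⟩ := hn
        refine Or.inr ⟨(e, p), (h.created_iff_broken hp hl hf hq).1 hc, ?_⟩
        obtain ⟨-, h1, h2⟩ := hE (e, p) hp.1
        obtain ⟨h3, h4⟩ := h2.ending_unique hl h1 hq
        exact Prod.ext h3 h4
    · rintro (⟨hf, hq, hn⟩ | ⟨x, hx, hxq⟩)
      · refine ⟨hf, hq, ?_⟩
        by_contra hc
        obtain ⟨e, p, hp, hl⟩ := h.initial_or_created (.ending f q hf (by exact hq)) le_rfl
          (h.together_ending hf hq) hc
        exact hn e p hp hl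
      · obtain ⟨h1, h2, h3⟩ := hE x hx.1.1
        rw [hxq] at h1 h2 h3
        exact ⟨h1, h2, (h.created_iff_broken hx.1 h3 h1 h2).2 hx⟩
  rw [heq, Set.ncard_union_eq _ finite_nonInitialEnding ((finite_brokenInitial S).image E),
    hinj.ncard_image]
  rw [Set.disjoint_left]
  rintro _ ⟨_, _, hn⟩ ⟨x, hx, rfl⟩
  exact hn _ _ hx.1 (hE x hx.1.1).2.2

/-! ### Chains of good pairs -/

/-- Two good pairs on `e`, where the lower line of the first is the upper line of the second. -/
def Next (I : PathNetwork L) (e : ℕ) (p q : ELine L × ELine L) : Prop :=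
  I.GoodPair e p ∧ I.GoodPair e q ∧ p.2 = q.1

theorem Next.fst_green {e : ℕ} {p q : ELine L × ELine L} (h : I.Next e p q)
    (hp : p.1 ∈ I.greens e) : q.1 ∈ I.greens e := by
  rw [← h.2.2]
  exact h.1.snd_green hp

theorem next_reflTransGen_fst_green {e : ℕ} {p q : ELine L × ELine L}
    (h : Relation.ReflTransGen (I.Next e) p q) (hp : p.1 ∈ I.greens e) : q.1 ∈ I.greens e := by
  induction h with
  | refl => exact hp
  | tail _ h ih => exact h.fst_green ih

theorem next_reflTransGen_snd_red {e : ℕ} {p q : ELine L × ELine L}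
    (h : Relation.ReflTransGen (I.Next e) p q) (hq : q.2 ∈ I.reds e) : p.2 ∈ I.reds e := by
  induction h with
  | refl => exact hq
  | tail _ h ih =>
    refine ih ?_
    rw [h.2.2]
    exact h.2.1.fst_red hq

/-- A chain of good pairs persists as long as its first and its last pair exist. -/
theorem next_reflTransGen_identified {e : ℕ} {p q p' q' : ELine L × ELine L}
    (h : Relation.ReflTransGen (I.Next e) p q) (hp : I.Identified e p p')
    (hq : I.Identified e q q') (hp' : I.GoodPair (e + 1) p') :
    Relation.ReflTransGen (I.Next (e + 1)) p' q' := by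
  induction h using Relation.ReflTransGen.head_induction_on generalizing p' with
  | refl => rw [hp.right_unique hq]
  | @head p r hpr hrq ih =>
    -- The line shared by `p` and `r` is black: green would propagate down the chain to `q.1`, and
    -- red is excluded because `p` continues on the next edge.
    have hr : I.Black e r.1 := by
      have h1 : r.1 ∉ I.greens e := fun h => hq.fst_not_green (next_reflTransGen_fst_green hrq h)
      have h2 : r.1 ∉ I.reds e := fun h => hp.snd_not_red (hpr.2.2 ▸ h)
      have h3 := hpr.2.1.color_fst
      tauto
    obtain ⟨r', hr', hgr'⟩ := hpr.2.1.exists_identified (Or.inl hr)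
    refine Relation.ReflTransGen.head ⟨hp', hgr', ?_⟩ (ih hr' hgr')
    rw [hr'.fst_eq hr, hp.snd_eq (hpr.2.2 ▸ hr), hpr.2.2]

theorem next_reflTransGen_linked {e f : ℕ} {p q p' q' : ELine L × ELine L}
    (h : Relation.ReflTransGen (I.Next e) p q) (hp : I.Linked e p f p') (hq : I.Linked e q f q') :
    Relation.ReflTransGen (I.Next f) p' q' := by
  induction hp generalizing q' with
  | refl _ => rwa [← hq.eq_of_eq]
  | next f p' p'' hp hi hg ih =>
    obtain ⟨s, hs, hs'⟩ := hq.split hp.le (Nat.le_succ f)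
    obtain ⟨u, hu, hu'⟩ := hs'.exists_next (Nat.lt_succ_self f)
    rw [hu'.eq_of_eq] at hu
    exact next_reflTransGen_identified (ih hs) hi hu hg

theorem next_reflTransGen_of_infix {e : ℕ} {b : List (ELine L)} (hb : I.GoodSequence e b)
    {p q : ELine L × ELine L} (hp : [p.1, p.2] <:+: b) (hq : [q.1, q.2] <:+: b) :
    Relation.ReflTransGen (I.Next e) p q ∨ Relation.ReflTransGen (I.Next e) q p := by
  have head : ∀ (c : List (ELine L)) (x y : ELine L), I.GoodSequence e (x :: y :: c) →
      ∀ q : ELine L × ELine L, [q.1, q.2] <:+: x :: y :: c →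
        Relation.ReflTransGen (I.Next e) (x, y) q := by
    intro c
    induction c with
    | nil =>
      intro x y _ q hq
      obtain ⟨q1, q2⟩ := q
      have := hq.eq_of_length (by simp)
      simp only [List.cons.injEq, and_true] at this
      obtain ⟨rfl, rfl⟩ := this
      exact .refl
    | cons z c ih =>
      intro x y h q hq
      have h' := List.isChain_cons_cons.1 h
      have h'' := List.isChain_cons_cons.1 h'.2
      rcases List.infix_cons_iff.1 hq with hq | hq
      · obtain ⟨q1, q2⟩ := q
        simp only [List.cons_prefix_cons, List.nil_prefix, and_true] at hq
        obtain ⟨rfl, rfl⟩ := hq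
        exact .refl
      · exact .head ⟨h'.1, h''.1, rfl⟩ (ih y z h'.2 q hq)
  obtain ⟨u, v, h⟩ := List.pair_infix_iff.1 hp
  obtain ⟨u', v', h'⟩ := List.pair_infix_iff.1 hq
  rcases le_total u.length u'.length with hle | hle
  · left
    refine head v p.1 p.2 (List.IsChain.infix hb ⟨u, [], by simp [h]⟩) q ?_
    obtain ⟨w, rfl⟩ : u <+: u' :=
      List.prefix_of_prefix_length_le ⟨_, h.symm⟩ ⟨_, h'.symm⟩ hle
    rw [h', List.append_assoc, List.append_cancel_left_eq] at h
    rw [← h]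
    exact List.pair_infix_iff.2 ⟨w, v', rfl⟩
  · right
    refine head v' q.1 q.2 (List.IsChain.infix hb ⟨u', [], by simp [h']⟩) p ?_
    obtain ⟨w, rfl⟩ : u' <+: u :=
      List.prefix_of_prefix_length_le ⟨_, h'.symm⟩ ⟨_, h.symm⟩ hle
    rw [h, List.append_assoc, List.append_cancel_left_eq] at h'
    rw [← h']
    exact List.pair_infix_iff.2 ⟨w, v, rfl⟩

/-- A good sequence that reaches from a red to a green line contains all pairs with black lines of
its chain. -/
theorem infix_of_next_reflTransGen {e : ℕ} {b : List (ELine L)} (hb : I.GoodSequence e b)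
    (hr : ∃ x ∈ b, x ∈ I.reds e) (hg : ∃ x ∈ b, x ∈ I.greens e) {p q : ELine L × ELine L}
    (hp : [p.1, p.2] <:+: b) (hq : I.Black e q.1 ∨ I.Black e q.2)
    (h : Relation.ReflTransGen (I.Next e) p q ∨ Relation.ReflTransGen (I.Next e) q p) :
    [q.1, q.2] <:+: b := by
  rcases h with h | h
  · induction h using Relation.ReflTransGen.head_induction_on with
    | refl => exact hp
    | @head p r hpr hrq ih =>
      refine ih ?_
      obtain ⟨u, v, rfl⟩ := List.pair_infix_iff.1 hp
      -- Below a green line all lines of the chain are green, but `q` has a black line.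
      have hng : r.1 ∉ I.greens e := fun h => by
        have h1 := next_reflTransGen_fst_green hrq h
        rcases hq with hq | hq
        · exact hq.not_green h1
        · rcases Relation.ReflTransGen.cases_tail hrq with h2 | ⟨s, -, h2⟩
          · subst h2; exact hq.not_green (hpr.2.1.snd_green h1)
          · exact hq.not_green (h2.2.1.snd_green h1)
      cases v with
      | nil =>
        -- If `b` ended with `p.2`, which is not green, it would contain no green line at all.
        obtain ⟨x, hx, hxg⟩ := hg
        have := List.IsChain.forall_of_getLast (P := fun x => x ∉ I.greens e) (l := u ++ [p.1])
          (a := p.2) (fun x y (h : I.GoodPair e (x, y)) hy hx => hy (h.snd_green hx))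
          (by rw [List.append_assoc]; exact hb) (by rwa [hpr.2.2]) x (by simpa using hx)
        exact (this hxg).elim
      | cons z v =>
        have hz : I.GoodPair e (p.2, z) :=
          List.IsChain.rel_of_pair_infix hb ⟨u ++ [p.1], v, by simp⟩
        have hr : I.GoodPair e (p.2, r.2) := by rw [hpr.2.2]; exact hpr.2.1
        rw [← hpr.2.2, hr.right_unique hz]
        exact ⟨u ++ [p.1], v, by simp⟩
  · induction h with
    | refl => exact hp
    | @tail r p hqr hrp ih =>
      refine ih ?_
      obtain ⟨u, v, rfl⟩ := List.pair_infix_iff.1 hp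
      have hnr : r.2 ∉ I.reds e := fun h => by
        have h1 := next_reflTransGen_snd_red hqr h
        rcases hq with hq | hq
        · rcases Relation.ReflTransGen.cases_head hqr with h2 | ⟨s, h2, -⟩
          · subst h2; exact hq.not_red (hrp.1.fst_red h1)
          · exact hq.not_red (h2.1.fst_red h1)
        · exact hq.not_red h1
      rcases List.eq_nil_or_concat u with rfl | ⟨u, z, rfl⟩
      · obtain ⟨x, hx, hxr⟩ := hr
        have := List.IsChain.forall_of_head (P := fun x => x ∉ I.reds e) (l := p.2 :: v)
          (a := p.1) (fun x y (h : I.GoodPair e (x, y)) hx hy => hx (h.fst_red hy))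
          hb (by rwa [← hrp.2.2]) x hx
        exact (this hxr).elim
      · have hz : I.GoodPair e (z, p.1) :=
          List.IsChain.rel_of_pair_infix hb ⟨u, p.2 :: v, by simp⟩
        have hr : I.GoodPair e (r.1, p.1) := by rw [← hrp.2.2]; exact hrp.1
        rw [hrp.2.2, hr.left_unique hz]
        exact ⟨u, p.2 :: v, by simp⟩

/-- In every feasible solution, the pairs with black lines of a sequence that contains red and green
lines but not all black lines cannot all survive. -/
theorem Feasible.exists_not_together {S : LineOrders L} (h : I.Feasible S) {e : ℕ}
    {b : List (ELine L)} (hb : I.GoodSequence e b) (hm : I.MustBreak e b) :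
    ∃ p, I.BlackPair e b p ∧ ¬ Together (S.π e (S.t e)) p := by
  by_contra hall
  push Not at hall
  obtain ⟨hr, hg, z, hz, hzb⟩ := hm
  have he := hz.lt_m
  have hnd := (h.isOrder (by omega : e < I.m) le_rfl).nodup_ext
  obtain ⟨mid, hmid, hext, -⟩ := h.exists_mid he
  have hgr : ∃ x ∈ b, x ∉ I.reds e := by
    obtain ⟨x, hx, hx'⟩ := hg
    exact ⟨x, hx, not_red_of_green hx'⟩
  -- `x` is the last red line of the sequence; the line `y₀` below it is black, as the path goes on
  -- after `e`.
  obtain ⟨u, x, y₀, v, rfl, hx, hy⟩ := List.IsChain.exists_split (P := fun x => x ∈ I.reds e)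
    (fun x y (h : I.GoodPair e (x, y)) hy => h.fst_red hy) hb hr hgr
  have hxy : I.GoodPair e (x, y₀) := List.IsChain.rel_of_pair_infix hb ⟨u, v, by simp⟩
  obtain ⟨hyb, -⟩ := hxy.black_snd he hx hy
  have hgv : ∃ w ∈ y₀ :: v, w ∈ I.greens e := by
    obtain ⟨w, hw, hw'⟩ := hg
    rcases List.mem_append.1 hw with hwu | hwu
    · have := List.IsChain.forall_of_getLast (P := fun x => x ∈ I.reds e)
        (fun x y (h : I.GoodPair e (x, y)) hy => h.fst_red hy) (l := u)
        (List.IsChain.infix hb ⟨[], y₀ :: v, by simp⟩) hx w (by simp [hwu])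
      exact (not_green_of_red this hw').elim
    · rcases List.mem_cons.1 hwu with rfl | hwu
      · exact (not_green_of_red hx hw').elim
      · exact ⟨w, hwu, hw'⟩
  -- The sequence and the final order are followed downwards in parallel. As long as the current
  -- line is black, the sequence goes on (a green line is still to come) and its next pair survives,
  -- so both lists continue with the same line. Thus the sequence contains all of `mid`.
  have key : ∀ (mid' v' : List (ELine L)) (y : ELine L), (∀ w ∈ y :: mid', I.Black e w) →
      (y :: mid') <:+: ext (S.π e (S.t e)) →
      (y :: v') <:+: (u ++ x :: y₀ :: v) →
      (∃ w ∈ y :: v', w ∈ I.greens e) → y :: mid' ⊆ y :: v' := by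
    intro mid'
    induction mid' with
    | nil => intro v' y _ _ _ _; simp
    | cons a mid' ih =>
      intro v' y hbl hext' hsub ⟨w, hw, hwg⟩
      have hy := hbl y (by simp)
      rcases v' with _ | ⟨c, v'⟩
      · obtain rfl : w = y := by simpa using hw
        exact (hy.not_green hwg).elim
      · have hyc : [y, c] <:+: (u ++ x :: y₀ :: v) :=
          List.IsInfix.trans ⟨[], v', by simp⟩ hsub
        obtain rfl : a = c := hnd.pair_infix_right_unique
          (List.IsInfix.trans ⟨[], mid', by simp⟩ hext') (hall (y, c) ⟨hyc, Or.inl hy⟩)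
        refine List.cons_subset_cons _ (ih v' a (fun w hw => hbl w (List.mem_cons_of_mem _ hw))
          (List.IsInfix.trans (List.suffix_cons _ _).isInfix hext')
          (List.IsInfix.trans (List.suffix_cons _ _).isInfix hsub) ⟨w, ?_, hwg⟩)
        rcases List.mem_cons.1 hw with rfl | hw
        · exact (hy.not_green hwg).elim
        · exact hw
  have hxy' : Together (S.π e (S.t e)) (x, y₀) := hall _ ⟨⟨u, v, by simp⟩, Or.inr hyb⟩
  have hxm : x ∉ mid ++ I.greens e := by
    rw [List.mem_append, not_or, hmid]
    exact ⟨fun h => h.not_red hx, not_green_of_red hx⟩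
  rw [Together, hext, List.pair_infix_append] at hxy'
  rcases hxy' with h' | h' | ⟨-, h'⟩
  · exact hy (List.mem_right_of_pair_infix h')
  · exact hxm (List.mem_left_of_pair_infix h')
  -- The surviving pair `(x, y₀)` crosses from the red lines to `mid`, so the parallel walk starts
  -- at the top of `mid`.
  · rcases mid with _ | ⟨c, mid⟩
    · exact absurd ((hmid z).2 hz) (by simp)
    · obtain rfl : c = y₀ := by simpa using h'
      have := key mid v c (fun w hw => (hmid w).1 hw)
        ⟨I.reds e, I.greens e, by rw [hext]; simp⟩ ⟨u ++ [x], [], by simp⟩ hgv ((hmid z).2 hz)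
      exact hzb (by simp only [List.mem_append, List.mem_cons] at this ⊢; tauto)

end PathNetwork

/-! ### Exchanges in the extended order that are block moves. -/

namespace ELine

variable {L : Type*}

theorem ext_injective : Function.Injective (ext : List L → List (ELine L)) := by
  intro π π' h
  simpa [ext, List.map_inj_right line_injective] using h

/-- `top` is first both before and after the exchange. Were `A` empty, `top` would head both `B` and
`C`, which are disjoint. The same argument with `bot` treats `D`. -/
theorem ne_nil_of_swap {π π' : List L} {A B C D : List (ELine L)} (hπ : π.Nodup)
    (h : ext π = A ++ B ++ C ++ D) (h' : ext π' = A ++ C ++ B ++ D) (hB : B ≠ []) (hC : C ≠ []) :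
    A ≠ [] ∧ D ≠ [] := by
  have hnd := nodup_ext.2 hπ
  rw [h] at hnd
  have hdis : ∀ x ∈ B, x ∉ C := fun x hx hx' => by
    have := (List.nodup_append.1 hnd.of_append_left).2.2 x (by simp [hx]) x hx'
    exact this rfl
  obtain ⟨b, B', rfl⟩ := List.exists_cons_of_ne_nil hB
  obtain ⟨c, C', rfl⟩ := List.exists_cons_of_ne_nil hC
  constructor
  · rintro rfl
    simp only [ext, List.nil_append, List.cons_append, List.cons.injEq] at h h'
    exact hdis top (by simp [h.1]) (by simp [h'.1])
  · rintro rfl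
    have h1 := congrArg List.getLast? h
    have h2 := congrArg List.getLast? h'
    have e1 : (c :: C').getLast? = some bot := by
      rw [List.append_nil, List.getLast?_append_of_ne_nil _ (by simp)] at h1
      rw [← h1]; simp [ext, List.getLast?_cons]
    have e2 : (b :: B').getLast? = some bot := by
      rw [List.append_nil, List.getLast?_append_of_ne_nil _ (by simp)] at h2
      rw [← h2]; simp [ext, List.getLast?_cons]
    exact hdis bot (List.mem_of_getLast? e2) (List.mem_of_getLast? e1)

theorem blockMove_of_swap {π π' : List L} {A B C D : List (ELine L)} (hπ : π.Nodup)
    (h : ext π = A ++ B ++ C ++ D) (h' : ext π' = A ++ C ++ B ++ D) (hB : B ≠ []) (hC : C ≠ []) :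
    BlockMove π π' := by
  obtain ⟨hA, hD⟩ := ne_nil_of_swap hπ h h' hB hC
  obtain ⟨a, b, c, d, rfl, rfl, rfl, rfl, rfl⟩ := ext_eq_append₄ h hA hD
  refine ⟨a, b, c, d, by simpa using hB, by simpa using hC, rfl, ext_injective ?_⟩
  rw [h', ext_append₄]

end ELine

theorem BlockMove.perm {L : Type*} {π π' : List L} (h : BlockMove π π') : π'.Perm π := by
  obtain ⟨A, B, C, D, -, -, rfl, rfl⟩ := h
  refine List.Perm.append_right _ ?_
  rw [List.append_assoc, List.append_assoc]
  exact List.Perm.append_left _ List.perm_append_comm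

namespace PathNetwork

open ELine

variable {L : Type*} [DecidableEq L] {I : PathNetwork L}

/-! ### The moves of the algorithm -/

/-- On the order `π e i`, the algorithm has to break the sequence `b` and may do so at `p`. -/
def Breaks (I : PathNetwork L) (S : LineOrders L) (e i : ℕ) (b : List (ELine L))
    (p : ELine L × ELine L) : Prop :=
  I.MustBreak e b ∧ I.GoodSequence e b ∧ b <:+: ext (S.π e i) ∧ I.BreakAt S e i b p

/-- At most one good pair is lost. The last placed line `c` has `r` as its good partner, so by
uniqueness neither the pair at `s|M` nor the pair at `M|moved` is good. The junction `moved|R` is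
not good by maximality, unless the sequence was broken there. -/
theorem RedMove.spec {S : LineOrders L} {e i : ℕ} (he : e < I.m) (ho : I.IsOrder e (S.π e i))
    (h : I.RedMove S e i) :
    ∃ s M moved R r, s ≠ [] ∧ s ++ [line r] <+: I.reds e ∧ ¬ s ++ [line r] <+: ext (S.π e i) ∧
      ext (S.π e i) = s ++ M ++ moved ++ R ∧ ext (S.π e (i + 1)) = s ++ moved ++ M ++ R ∧
      M ≠ [] ∧ moved.head? = some (line r) ∧
      ∃ b p₀, ∀ p, I.GoodPair e p → Together (S.π e i) p → ¬ Together (S.π e (i + 1)) p →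
        p = p₀ ∧ I.Breaks S e i b p := by
  obtain ⟨s, r, b, moved, ⟨h1, h2, h3⟩, ⟨A, C, hb, hbr, hgs, hmax⟩, hcase, M, R, hM, hM'⟩ := h
  have hnd := ho.nodup_ext
  have hs : s ≠ [] := by
    rintro rfl
    simp [reds] at h1
  obtain ⟨b', rfl⟩ := List.head?_eq_some_iff.1 hbr
  have hmr : moved.head? = some (line r) := by
    rcases hcase with ⟨-, rfl⟩ | ⟨-, B, C', x, y, hB, -, rfl⟩
    · exact hbr
    · cases B <;> simp_all
  obtain ⟨mv, rfl⟩ := List.head?_eq_some_iff.1 hmr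
  have hMne : M ≠ [] := by
    rintro rfl
    refine h3 ⟨mv ++ R, ?_⟩
    rw [hM]; simp
  have hRC : mv ++ R = b' ++ C := by
    have e1 : ext (S.π e i) = (s ++ M) ++ line r :: (mv ++ R) := by rw [hM]; simp
    have e2 : ext (S.π e i) = A ++ line r :: (b' ++ C) := by rw [hb]; simp
    rw [e1] at hnd
    exact (hnd.append_cons_inj (e1.symm.trans e2)).2
  refine ⟨s, M, line r :: mv, R, r, hs, h1, h3, hM, hM', hMne, rfl, line r :: b',
    ((line r :: mv).getLast?.getD top, R.head?.getD top), ?_⟩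
  rintro ⟨p1, p2⟩ hp ht ht'
  obtain ⟨c, hc, hcr⟩ := List.exists_adjacent_of_ne_nil hs (a := line r)
  replace hcr := hcr.trans h1.isInfix
  have hgood := goodPair_of_infix_reds he hcr
  have hnd' := hnd
  rw [hM] at hnd'
  rw [Together, hM] at ht
  rw [Together, hM'] at ht'
  rcases List.pair_infix_swap ht hMne (by simp) with h | ⟨ha, hb'⟩ | ⟨ha, hb'⟩ | ⟨ha, hb'⟩
  · exact (ht' h).elim
  · obtain rfl : c = p1 := by simpa [hc] using ha
    obtain rfl : p2 = line r := hp.right_unique hgood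
    exact ((List.nodup_append.1 hnd'.of_append_left).2.2 (line r)
      (by simp [List.mem_of_head? hb']) (line r) (by simp) rfl).elim
  · obtain rfl : line r = p2 := by simpa using hb'
    obtain rfl : p1 = c := hp.left_unique hgood
    exact ((List.nodup_append.1 hnd'.of_append_left.of_append_left).2.2 p1
      (List.mem_of_getLast? hc) p1 (List.mem_of_getLast? ha) rfl).elim
  · refine ⟨by rw [ha, hb']; rfl, ?_⟩
    rcases hcase with ⟨-, hmv⟩ | ⟨hm, B, C', x, y, hB, hbrk, hmv⟩
    · obtain rfl : mv = b' := by simpa using hmv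
      obtain rfl : R = C := by simpa using hRC
      exact (hmax p1 ha p2 hb' hp).elim
    · have hxy : x = p1 ∧ y = p2 := by
        rw [hmv] at ha
        have hR : R = y :: C' ++ C := by
          have e1 : line r :: mv ++ R = line r :: b' ++ C := by simpa using hRC
          rw [hB, hmv] at e1
          simpa using e1
        rw [hR] at hb'
        simp at ha hb'
        exact ⟨ha, hb'⟩
      obtain ⟨rfl, rfl⟩ := hxy
      exact ⟨hm, hgs, ⟨A, C, hb.symm⟩, hbrk⟩

/-- The mirror image of `RedMove.spec`, except that the red lines, already in place, must also be
shown to stay above the moved block. -/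
theorem GreenMove.spec {S : LineOrders L} {e i : ℕ} (he : e < I.m) (ho : I.IsOrder e (S.π e i))
    (h : I.GreenMove S e i) :
    ∃ s M moved R g, s ≠ [] ∧ line g :: s <:+ I.greens e ∧ ¬ line g :: s <:+ ext (S.π e i) ∧
      ext (S.π e i) = R ++ moved ++ M ++ s ∧ ext (S.π e (i + 1)) = R ++ M ++ moved ++ s ∧
      M ≠ [] ∧ moved.getLast? = some (line g) ∧ I.reds e <+: R ∧
      ∃ b p₀, ∀ p, I.GoodPair e p → Together (S.π e i) p → ¬ Together (S.π e (i + 1)) p →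
        p = p₀ ∧ I.Breaks S e i b p := by
  obtain ⟨hreds, g, s, b, moved, ⟨h1, h2, h3⟩, ⟨A, C, hb, hbg, hgs, hmax⟩, hcase, R, M, hM, hM'⟩ := h
  have hnd := ho.nodup_ext
  have hs : s ≠ [] := by
    rintro rfl
    obtain ⟨w, hw⟩ := h1
    have := congrArg List.getLast? hw
    simp [greens] at this
  obtain ⟨b', rfl⟩ := List.getLast?_eq_some_iff.1 hbg
  have hmg : moved.getLast? = some (line g) := by
    rcases hcase with ⟨-, rfl⟩ | ⟨-, B, C', x, y, hB, -, rfl⟩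
    · exact hbg
    · rw [hB] at hbg
      simpa [List.getLast?_cons] using hbg
  obtain ⟨mv, rfl⟩ := List.getLast?_eq_some_iff.1 hmg
  have hMne : M ≠ [] := by
    rintro rfl
    refine h3 ⟨R ++ mv, ?_⟩
    rw [hM]; simp
  have hRA : R ++ mv = A ++ b' := by
    have e1 : ext (S.π e i) = (R ++ mv) ++ line g :: (M ++ s) := by rw [hM]; simp
    have e2 : ext (S.π e i) = (A ++ b') ++ line g :: C := by rw [hb]; simp
    rw [e1] at hnd
    exact (hnd.append_cons_inj (e1.symm.trans e2)).1
  have hRA' : R ++ (mv ++ [line g]) = A ++ (b' ++ [line g]) := by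
    rw [← List.append_assoc, hRA, List.append_assoc]
  have hRne : R ≠ [] := (ne_nil_of_swap ho.1 hM hM' (by simp) hMne).1
  -- It suffices that the top line `z` of the moved block is not red. If the whole sequence is
  -- moved, a red `z` would form a good pair with the line above it, against maximality. If the
  -- sequence is broken above `z`, a red `z` would make both lines of the breaking pair red,
  -- although one is black.
  have hredsR : I.reds e <+: R := by
    obtain ⟨z, N, hz⟩ := List.exists_cons_of_ne_nil
      (show mv ++ [line g] ≠ [] by simp)
    have hzr : z ∉ I.reds e := by
      rcases hcase with ⟨-, hmv⟩ | ⟨hm, B, C', x, y, hB, hbrk, hmv⟩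
      · intro hzr
        rw [← hmv] at hRA' hmax
        obtain rfl : R = A := List.append_cancel_right hRA'
        obtain ⟨R, a, rfl⟩ := (List.eq_nil_or_concat' R).resolve_left hRne
        refine hmax a (by simp) z (by simp [hz]) (goodPair_of_infix_reds he ?_)
        obtain ⟨T, hT⟩ := hreds
        have hzT : z ∉ T := fun h => by
          rw [← hT, List.nodup_append] at hnd
          exact hnd.2.2 z hzr z h rfl
        rw [← List.pair_infix_iff_of_disjoint_right hzT, hT, hM, hz]
        exact ⟨R, N ++ M ++ s, by simp⟩
      · obtain rfl : z = y := by
          have := hz.symm.trans hmv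
          simp at this; exact this.1
        intro hzr
        have hxz : I.GoodPair e (x, z) := List.IsChain.rel_of_pair_infix hgs
          ⟨B, C', by simp [hB]⟩
        rcases hbrk.1.2 with hbl | hbl
        · exact hbl.not_red (hxz.fst_red hzr)
        · exact hbl.not_red hzr
    rw [hM, hz, List.append_assoc, List.append_assoc] at hreds
    rcases List.prefix_or_prefix_of_prefix hreds (List.prefix_append R _) with h | ⟨w, hw⟩
    · exact h
    · cases w with
      | nil => rw [← hw]; simp
      | cons a w =>
        rw [← hw] at hreds
        have := (List.prefix_append_right_inj R).1 hreds
        simp at this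
        exact (hzr (by rw [← hw]; simp [this.1])).elim
  refine ⟨s, M, mv ++ [line g], R, g, hs, h1, h3, hM, hM', hMne, by simp, hredsR, b' ++ [line g],
    (R.getLast?.getD top, (mv ++ [line g]).head?.getD top), ?_⟩
  rintro ⟨p1, p2⟩ hp ht ht'
  obtain ⟨c, s', rfl⟩ := List.exists_cons_of_ne_nil hs
  have hgood : I.GoodPair e (line g, c) := goodPair_of_infix_greens he
    (List.IsInfix.trans ⟨[], s', by simp⟩ h1.isInfix)
  have hnd' := hnd
  rw [hM] at hnd'
  rw [Together, hM] at ht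
  rw [Together, hM'] at ht'
  rcases List.pair_infix_swap ht (by simp) hMne with h | ⟨ha, hb'⟩ | ⟨ha, hb'⟩ | ⟨ha, hb'⟩
  · exact (ht' h).elim
  · refine ⟨by rw [ha, hb']; rfl, ?_⟩
    rcases hcase with ⟨-, hmv⟩ | ⟨hm, B, C', x, y, hB, hbrk, hmv⟩
    · rw [← hmv] at hRA' hmax
      obtain rfl : R = A := List.append_cancel_right hRA'
      exact (hmax p1 ha p2 hb' hp).elim
    · have hxy : x = p1 ∧ y = p2 := by
        have hR : R = A ++ (B ++ [x]) := by
          rw [hB, hmv] at hRA'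
          have e1 : R ++ (y :: C') = (A ++ (B ++ [x])) ++ (y :: C') := by rw [hRA']; simp
          exact List.append_cancel_right e1
        rw [hmv] at hb'
        rw [hR] at ha
        simp [List.getLast?_append] at ha hb'
        exact ⟨ha, hb'⟩
      obtain ⟨rfl, rfl⟩ := hxy
      exact ⟨hm, hgs, ⟨A, C, hb.symm⟩, hbrk⟩
  · obtain rfl : line g = p1 := by simpa using ha
    obtain rfl : p2 = c := hp.right_unique hgood
    exact ((List.nodup_append.1 hnd').2.2 p2
      (by simp [List.mem_of_head? hb']) p2 (by simp) rfl).elim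
  · obtain rfl : c = p2 := by simpa using hb'
    obtain rfl : p1 = line g := hp.left_unique hgood
    exact ((List.nodup_append.1 hnd'.of_append_left).2.2 (line g)
      (by simp) (line g) (List.mem_of_getLast? ha) rfl).elim

theorem RedMove.blockMove {S : LineOrders L} {e i : ℕ} (he : e < I.m)
    (ho : I.IsOrder e (S.π e i)) (h : I.RedMove S e i) :
    BlockMove (S.π e i) (S.π e (i + 1)) := by
  obtain ⟨s, M, moved, R, r, -, -, -, h1, h2, hM, hr, -⟩ := h.spec he ho
  exact blockMove_of_swap ho.1 h1 h2 hM (by rintro rfl; simp at hr)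

theorem GreenMove.blockMove {S : LineOrders L} {e i : ℕ} (he : e < I.m)
    (ho : I.IsOrder e (S.π e i)) (h : I.GreenMove S e i) :
    BlockMove (S.π e i) (S.π e (i + 1)) := by
  obtain ⟨s, M, moved, R, g, -, -, -, h1, h2, hM, hg, -⟩ := h.spec he ho
  exact blockMove_of_swap ho.1 h1 h2 (by rintro rfl; simp at hg) hM

/-- The pair `p` belongs to the red lines at their final place in `π`, or to the green ones, if all
red lines are in place. -/
def Placed (I : PathNetwork L) (e : ℕ) (π : List L) (p : ELine L × ELine L) : Prop :=
  (∃ s, s <+: I.reds e ∧ s <+: ext π ∧ [p.1, p.2] <:+: s) ∨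
    (I.reds e <+: ext π ∧ ∃ s, s <:+ I.greens e ∧ s <:+ ext π ∧ [p.1, p.2] <:+: s)

theorem Placed.together {e : ℕ} {π : List L} {p : ELine L × ELine L} (h : I.Placed e π p) :
    Together π p := by
  rcases h with ⟨s, -, h, h'⟩ | ⟨-, s, -, h, h'⟩
  · exact h'.trans h.isInfix
  · exact h'.trans h.isInfix

/-- The next red line is not in place, so the placed red lines under consideration lie within the
untouched prefix `s`, and the alternative about green lines cannot occur yet. -/
theorem Placed.redMove {S : LineOrders L} {e i : ℕ} {p : ELine L × ELine L} (he : e < I.m)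
    (ho : I.IsOrder e (S.π e i)) (h : I.RedMove S e i) (hp : I.Placed e (S.π e i) p) :
    I.Placed e (S.π e (i + 1)) p := by
  obtain ⟨s, M, moved, R, r, -, hs, hn, h1, h2, -⟩ := h.spec he ho
  rcases hp with ⟨s', hs', hx, hp⟩ | ⟨hx, -⟩
  · refine Or.inl ⟨s', hs', ?_, hp⟩
    rcases List.prefix_or_prefix_of_prefix hs' hs with h | h
    · rcases List.prefix_concat_iff.1 h with rfl | h
      · exact (hn hx).elim
      · refine h.trans ?_
        rw [h2, List.append_assoc, List.append_assoc]
        exact List.prefix_append _ _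
    · exact (hn (h.trans hx)).elim
  · exact (hn (hs.trans hx)).elim

theorem Placed.greenMove {S : LineOrders L} {e i : ℕ} {p : ELine L × ELine L} (he : e < I.m)
    (ho : I.IsOrder e (S.π e i)) (h : I.GreenMove S e i) (hp : I.Placed e (S.π e i) p) :
    I.Placed e (S.π e (i + 1)) p := by
  have hr := h.1
  obtain ⟨s, M, moved, R, g, -, hs, hn, h1, h2, -, -, hR, -⟩ := h.spec he ho
  have hR' : I.reds e <+: ext (S.π e (i + 1)) := by
    rw [h2, List.append_assoc, List.append_assoc]
    exact hR.trans (List.prefix_append _ _)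
  rcases hp with ⟨s', hs', hx, hp⟩ | ⟨-, s', hs', hx, hp⟩
  · exact Or.inl ⟨s', hs', hs'.trans hR', hp⟩
  · refine Or.inr ⟨hR', s', hs', ?_, hp⟩
    rcases List.suffix_or_suffix_of_suffix hs' hs with h | h
    · rcases List.suffix_cons_iff.1 h with rfl | h
      · exact (hn hx).elim
      · refine h.trans ?_
        rw [h2]
        exact List.suffix_append _ _
    · exact (hn (h.trans hx)).elim

/-- Every move of the algorithm brings a pair of consecutive lines to its final place. -/
theorem RedMove.exists_placed {S : LineOrders L} {e i : ℕ} (he : e < I.m)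
    (ho : I.IsOrder e (S.π e i)) (h : I.RedMove S e i) :
    ∃ p, I.EndConsecutive e p ∧ ¬ Together (S.π e i) p ∧ I.Placed e (S.π e (i + 1)) p := by
  have hnd := ho.nodup_ext
  obtain ⟨s, M, moved, R, r, hs, hr, hn, h1, h2, hM, hmr, -⟩ := h.spec he ho
  obtain ⟨c, hc, hcr⟩ := List.exists_adjacent_of_ne_nil hs (a := line r)
  obtain ⟨mv, rfl⟩ := List.head?_eq_some_iff.1 hmr
  refine ⟨(c, line r), Or.inl (hcr.trans hr.isInfix), fun ht => ?_, Or.inl ⟨_, hr, ?_, hcr⟩⟩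
  · obtain ⟨z, M, rfl⟩ := List.exists_cons_of_ne_nil hM
    obtain ⟨s, rfl⟩ := List.getLast?_eq_some_iff.1 hc
    have : [c, z] <:+: ext (S.π e i) := ⟨s, M ++ (line r :: mv) ++ R, by rw [h1]; simp⟩
    obtain rfl := hnd.pair_infix_right_unique ht this
    exact hn ⟨M ++ line r :: mv ++ R, by rw [h1]; simp⟩
  · exact ⟨mv ++ M ++ R, by rw [h2]; simp⟩

theorem GreenMove.exists_placed {S : LineOrders L} {e i : ℕ} (he : e < I.m)
    (ho : I.IsOrder e (S.π e i)) (h : I.GreenMove S e i) :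
    ∃ p, I.EndConsecutive e p ∧ ¬ Together (S.π e i) p ∧ I.Placed e (S.π e (i + 1)) p := by
  have hnd := ho.nodup_ext
  obtain ⟨s, M, moved, R, g, hs, hg, hn, h1, h2, hM, hmg, hR, -⟩ := h.spec he ho
  obtain ⟨c, s, rfl⟩ := List.exists_cons_of_ne_nil hs
  obtain ⟨mv, rfl⟩ := List.getLast?_eq_some_iff.1 hmg
  have hcg : [line g, c] <:+: line g :: c :: s := ⟨[], s, by simp⟩
  refine ⟨(line g, c), Or.inr (Or.inl (hcg.trans hg.isInfix)), fun ht => ?_,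
    Or.inr ⟨?_, _, hg, ?_, hcg⟩⟩
  · obtain ⟨M, z, rfl⟩ := (List.eq_nil_or_concat' M).resolve_left hM
    have : [z, c] <:+: ext (S.π e i) := ⟨R ++ (mv ++ [line g]) ++ M, s, by rw [h1]; simp⟩
    obtain rfl := hnd.pair_infix_left_unique ht this
    exact hn ⟨R ++ (mv ++ [line g]) ++ M, by rw [h1]; simp⟩
  · rw [h2, List.append_assoc, List.append_assoc]
    exact hR.trans (List.prefix_append _ _)
  · exact ⟨R ++ M ++ mv, by rw [h2]; simp⟩

/-! ### Runs of the algorithm -/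

/-- The algorithm starts on the edge `e` with the prescribed order and makes `n` moves. -/
def RunOn (I : PathNetwork L) (S : LineOrders L) (e n : ℕ) : Prop :=
  S.π e 0 = I.leftOrder S e ∧ ∀ i < n, I.RedMove S e i ∨ I.GreenMove S e i

theorem RunOn.isOrder {S : LineOrders L} {e n : ℕ} (hprev : ∀ f < e, I.RunOn S f (S.t f))
    (he : e < I.m) (h : I.RunOn S e n) {i : ℕ} (hi : i ≤ n) : I.IsOrder e (S.π e i) := by
  induction e generalizing n i with
  | zero =>
    induction i with
    | zero => rw [h.1]; exact isOrder_leftOrder_zero S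
    | succ i ih =>
      have ho := ih (by omega)
      rcases h.2 i hi with h | h
      · exact ho.of_perm (h.blockMove he ho).perm
      · exact ho.of_perm (h.blockMove he ho).perm
  | succ e ihe =>
    induction i with
    | zero =>
      rw [h.1]
      exact isOrder_leftOrder_succ (ihe (fun f hf => hprev f (by omega)) (by omega)
        (hprev e (by omega)) le_rfl)
    | succ i ih =>
      have ho := ih (by omega)
      rcases h.2 i hi with h | h
      · exact ho.of_perm (h.blockMove he ho).perm
      · exact ho.of_perm (h.blockMove he ho).perm

theorem AlgorithmRun.runOn {S : LineOrders L} (h : I.AlgorithmRun S) {e : ℕ} (he : e < I.m) :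
    I.RunOn S e (S.t e) := ⟨h.start e he, h.move e he⟩

theorem AlgorithmRun.isOrder {S : LineOrders L} (h : I.AlgorithmRun S) {e i : ℕ} (he : e < I.m)
    (hi : i ≤ S.t e) : I.IsOrder e (S.π e i) :=
  (h.runOn he).isOrder (fun _ hf => h.runOn (hf.trans he)) he hi

theorem exists_middle {e : ℕ} {π : List L} (h1 : I.reds e <+: ext π) (h2 : I.greens e <:+ ext π) :
    ∃ b, π = I.endsAbove (e + 1) ++ b ++ I.endsBelow (e + 1) := by
  obtain ⟨T, hT⟩ := h1
  have hg : I.greens e <:+ T := by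
    rw [← hT] at h2
    rcases List.suffix_or_suffix_of_suffix h2 (List.suffix_append (I.reds e) T) with h | ⟨W, hW⟩
    · exact h
    · rcases W with _ | ⟨w, W⟩
      · rw [← hW]; simp
      · rw [← hW] at h2
        have hw : w ∈ I.reds e :=
          ((List.suffix_append_inj_of_length_eq rfl).1 h2).1.subset (by simp)
        exact (not_green_of_red hw (by rw [← hW]; simp)).elim
  obtain ⟨N, rfl⟩ := hg
  obtain ⟨a, b, c, d, rfl, ha, hb, hc, hd⟩ := ext_eq_append₄ (A := I.reds e) (B := N) (C := [])
    (D := I.greens e) (by rw [← hT]; simp) (by simp [reds]) (by simp [greens])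
  refine ⟨b, ?_⟩
  obtain rfl : c = [] := by simpa using hc.symm
  have ha' : I.endsAbove (e + 1) = a := by
    simpa [reds, List.map_inj_right line_injective] using ha
  have hd' : I.endsBelow (e + 1) = d := by
    simpa [greens, List.map_inj_right line_injective] using hd
  rw [ha', hd', List.append_nil]

/-- Only consistency on the right needs an argument: between the placed red and green lines exactly
the continuing lines remain, and the next edge starts with them in the same order. -/
theorem AlgorithmRun.feasible {S : LineOrders L} (h : I.AlgorithmRun S) : I.Feasible S where
  orders e he i hi := h.isOrder he hi
  moves e he i hi := by
    have ho := h.isOrder he hi.le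
    exact (h.move e he i hi).elim (fun h => h.blockMove he ho) fun h => h.blockMove he ho
  consistent_left := h.start
  consistent_right e he := by
    have ho := h.isOrder he le_rfl
    obtain ⟨b, hb⟩ := exists_middle (h.finish e he).1 (h.finish e he).2
    have hends : ∀ l, l ∈ I.endsAbove (e + 1) ++ I.endsBelow (e + 1) → ¬ I.On (e + 1) l := by
      intro l hl
      rw [(I.endsAbove_endsBelow (e + 1)).2] at hl
      omega
    have hbl : ∀ l ∈ b, I.On (e + 1) l := by
      intro l hl
      have hon : I.On e l := (ho.2 l).1 (by rw [hb]; simp [hl])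
      have hnd := ho.1
      rw [hb, List.nodup_append] at hnd
      have hnot : l ∉ I.endsAbove (e + 1) ++ I.endsBelow (e + 1) := by
        rw [List.mem_append, not_or]
        exact ⟨fun h => (List.nodup_append.1 hnd.1).2.2 l h l hl rfl,
          fun h => hnd.2.2 l (by simp [hl]) l h rfl⟩
      rw [(I.endsAbove_endsBelow (e + 1)).2] at hnot
      omega
    have hfilter : (S.π e (S.t e)).filter (fun l => I.On (e + 1) l) = b := by
      have h1 : (I.endsAbove (e + 1)).filter (fun l => I.On (e + 1) l) = [] :=
        List.filter_eq_nil_iff.2 fun l hl => by simpa using hends l (by simp [hl])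
      have h2 : (I.endsBelow (e + 1)).filter (fun l => I.On (e + 1) l) = [] :=
        List.filter_eq_nil_iff.2 fun l hl => by simpa using hends l (by simp [hl])
      have h3 : b.filter (fun l => I.On (e + 1) l) = b :=
        List.filter_eq_self.2 fun l hl => by simpa using hbl l hl
      rw [hb, List.filter_append, List.filter_append, h1, h2, h3]
      simp
    rw [rightOrder]
    split_ifs with hm
    · rw [h.start (e + 1) hm, filter_leftOrder ho, hfilter]
      exact hb
    · obtain rfl : b = [] := List.eq_nil_iff_forall_not_mem.2 fun l hl => by
        have h1 := hbl l hl
        have h2 := I.last_le l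
        omega
      exact hb

/-! ### The number of block crossings of the algorithm -/

theorem AlgorithmRun.placed {S : LineOrders L} (h : I.AlgorithmRun S) {e i j : ℕ}
    {p : ELine L × ELine L} (he : e < I.m) (hij : i ≤ j) (hj : j ≤ S.t e)
    (hp : I.Placed e (S.π e i) p) : I.Placed e (S.π e j) p := by
  induction j, hij using Nat.le_induction with
  | base => exact hp
  | succ j hij ih =>
    have ho := h.isOrder (i := j) he (by omega)
    rcases h.move e he j (by omega) with hm | hm
    · exact (ih (by omega)).redMove he ho hm
    · exact (ih (by omega)).greenMove he ho hm

/-- Each move is assigned the ending pair that it puts in place. The pair is absent before the move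
and present at all later times on the edge, so two moves on one edge cannot have the same pair. -/
theorem AlgorithmRun.cost_le [Finite L] {S : LineOrders L} (h : I.AlgorithmRun S) :
    I.cost S ≤ (I.createdEnding S).ncard := by
  have hex : ∀ x : (Σ _ : ℕ, ℕ), ∃ p, x.1 < I.m → x.2 < S.t x.1 →
      I.EndConsecutive x.1 p ∧ ¬ Together (S.π x.1 x.2) p ∧
        ∀ j, x.2 < j → j ≤ S.t x.1 → Together (S.π x.1 j) p := by
    rintro ⟨e, i⟩
    by_cases hx : e < I.m ∧ i < S.t e
    · have ho := h.isOrder hx.1 hx.2.le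
      obtain ⟨p, h1, h2, h3⟩ := (h.move e hx.1 i hx.2).elim
        (fun hm => hm.exists_placed hx.1 ho) (fun hm => hm.exists_placed hx.1 ho)
      exact ⟨p, fun _ _ => ⟨h1, h2, fun j hj hj' => (h.placed hx.1 hj hj' h3).together⟩⟩
    · exact ⟨(top, top), fun h1 h2 => (hx ⟨h1, h2⟩).elim⟩
  choose p hp using hex
  let T := (Finset.range I.m).sigma fun e => Finset.range (S.t e)
  have hT : T.card = I.cost S := by simp [T, cost]
  have hmem : ∀ x ∈ (T : Set (Σ _ : ℕ, ℕ)), x.1 < I.m ∧ x.2 < S.t x.1 := by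
    intro x hx
    simpa [T] using hx
  rw [← hT, ← Set.ncard_coe_finset]
  refine Set.ncard_le_ncard_of_injOn (fun x => (x.1, p x)) ?_ ?_ (finite_createdEnding S)
  · intro x hx
    obtain ⟨h1, h2⟩ := hmem x hx
    obtain ⟨h3, h4, h5⟩ := hp x h1 h2
    exact ⟨h1, h3, x.1, p x, x.2, .refl (.ending _ _ h1 h3), Or.inr ⟨rfl, h2⟩, h4,
      h5 _ (Nat.lt_succ_self _) h2⟩
  · rintro ⟨e, i⟩ hx ⟨f, j⟩ hy hxy
    obtain ⟨h1, h2⟩ := hmem _ hx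
    obtain ⟨h1', h2'⟩ := hmem _ hy
    obtain ⟨-, h4, h5⟩ := hp _ h1 h2
    obtain ⟨-, h4', h5'⟩ := hp _ h1' h2'
    obtain ⟨rfl, hpp⟩ : e = f ∧ p ⟨e, i⟩ = p ⟨f, j⟩ := by simpa using hxy
    rcases lt_trichotomy i j with hij | rfl | hij
    · exact (h4' (hpp ▸ h5 j hij h2'.le)).elim
    · rfl
    · exact (h4 (hpp ▸ h5' i hij h2.le)).elim

/-! ### Breaking initial pairs -/

/-- Case (ii) of the breaking rule: on `π e i` the algorithm breaks the sequence `b`, none of whose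
pairs with black lines has been created before, at the pair `p`, which ends last. -/
def BreaksUncreated (I : PathNetwork L) (S : LineOrders L) (e i : ℕ) (b : List (ELine L))
    (p : ELine L × ELine L) : Prop :=
  I.MustBreak e b ∧ I.GoodSequence e b ∧ b <:+: ext (S.π e i) ∧ I.BlackPair e b p ∧
    (∀ q, I.BlackPair e b q → ¬ I.Created S e i q) ∧
    ∀ q, I.BlackPair e b q → ∀ f, I.ExistsUntil e q f → I.ExistsUntil e p f

theorem AlgorithmRun.exists_breaks {S : LineOrders L} (h : I.AlgorithmRun S) {e i : ℕ}
    (he : e < I.m) (hi : i < S.t e) : ∃ b p₀, ∀ p, I.GoodPair e p → Together (S.π e i) p →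
      ¬ Together (S.π e (i + 1)) p → p = p₀ ∧ I.Breaks S e i b p := by
  have ho := h.isOrder he hi.le
  rcases h.move e he i hi with h | h
  · obtain ⟨_, _, _, _, _, -, -, -, -, -, -, -, h⟩ := h.spec he ho
    exact h
  · obtain ⟨_, _, _, _, _, -, -, -, -, -, -, -, -, h⟩ := h.spec he ho
    exact h

/-- Sequences that the algorithm breaks at different times by case (ii) share no pairs. -/
theorem Feasible.not_linked_of_breaksUncreated {S : LineOrders L} (h : I.Feasible S)
    {e i f j : ℕ} {b c : List (ELine L)} {p q r s : ELine L × ELine L} (hi : i < S.t e)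
    (hj : j ≤ S.t f) (hef : e < f ∨ e = f ∧ i < j) (hb : I.BreaksUncreated S e i b p)
    (hc : I.BreaksUncreated S f j c q) (hp : ¬ Together (S.π e (i + 1)) p)
    (hr : I.BlackPair e b r) (hs : I.BlackPair f c s) : ¬ I.Linked e r f s := by
  intro hl
  obtain ⟨-, hbg, -, hbp, -, hlast⟩ := hb
  obtain ⟨⟨hcr, hcg, -⟩, hcgs, hcext, -, hnc, -⟩ := hc
  -- As `s` contains a black line on `f`, it lives on to `f + 1`. Since `p` ends last among the
  -- pairs of `b`, it also reaches `f + 1`, and so its member `p''` on `f` contains a black line.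
  obtain ⟨s', hss', hs'⟩ := hl.good_right.exists_identified hs.2
  obtain ⟨p', hp'⟩ := hlast r hr (f + 1) ⟨s', .next _ _ _ hl hss' hs'⟩
  obtain ⟨p'', hp'', hp'⟩ := hp'.split hl.le (Nat.le_succ f)
  obtain ⟨_, hid, -⟩ := hp'.exists_next (Nat.lt_succ_self f)
  -- `p` and `r` lie on one chain of good pairs, and this persists for `p''` and `s`. The sequence
  -- `c` reaches from red to green, so it contains every pair with a black line on the chain of `s`.
  have hin : [p''.1, p''.2] <:+: c := by
    refine infix_of_next_reflTransGen hcgs hcr hcg hs.1 hid.black ?_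
    exact (next_reflTransGen_of_infix hbg hr.1 hbp.1).imp
      (fun h => next_reflTransGen_linked h hl hp'')
      (fun h => next_reflTransGen_linked h hp'' hl)
  -- `p` was absent after its break and `p''` is present now, so the class was created in between,
  -- which case (ii) excludes for `c`.
  refine hnc p'' ⟨hin, hid.black⟩ (h.created hp'' hp hi ?_ hj (hin.trans hcext))
  rcases hef with h | h
  · exact Or.inl h
  · exact Or.inr h.2

/-- An injection: the first break of an initial pair is charged to the root of a pair in the same
sequence that is not kept by `S'`. -/
theorem AlgorithmRun.ncard_brokenInitial_le [Finite L] {S S' : LineOrders L}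
    (h : I.AlgorithmRun S) (h' : I.Feasible S') :
    (I.brokenInitial S).ncard ≤ (I.brokenInitial S').ncard := by
  have hS := h.feasible
  have hex : ∀ x : ℕ × ELine L × ELine L, ∃ y : ℕ × ELine L × ELine L, x ∈ I.brokenInitial S →
      y ∈ I.brokenInitial S' ∧ ∃ f q j b r, I.Linked x.1 x.2 f q ∧ j < S.t f ∧
        Together (S.π f j) q ∧ ¬ Together (S.π f (j + 1)) q ∧ I.BreaksUncreated S f j b q ∧
        I.BlackPair f b r ∧ I.Linked y.1 y.2 f r := by
    intro x
    by_cases hx : x ∈ I.brokenInitial S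
    · obtain ⟨f, q, j, hl, hj, ht, ht', hc⟩ := hS.exists_first_break (e := x.1) (p := x.2) hx
      have hf := hl.good_right.lt_m
      obtain ⟨b, p₀, hb⟩ := h.exists_breaks hf hj
      obtain ⟨-, hm, hg, hbx, hbp, hbr⟩ := hb q hl.good_right ht ht'
      obtain ⟨hnc, hlast⟩ := hbr.resolve_left hc
      obtain ⟨r, hr, hrt⟩ := h'.exists_not_together hg hm
      have hrg : I.GoodPair f r := List.IsChain.rel_of_pair_infix hg hr.1
      -- The lost pair `r` is present in the algorithm's order and has not been created, so it stems
      -- from an initial pair. The notion of initial pair is independent of the solution, so `S'`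
      -- breaks that very pair.
      obtain ⟨g, y, hy, hyl⟩ := hS.initial_or_created hrg hj.le (hr.1.trans hbx) (hnc r hr)
      refine ⟨(g, y), fun _ => ⟨?_, f, q, j, b, r, hl, hj, ht, ht',
        ⟨hm, hg, hbx, hbp, hnc, hlast⟩, hr, hyl⟩⟩
      by_contra hby
      exact hrt (h'.together_of_not_broken hy hby hyl le_rfl)
    · exact ⟨x, fun h => (hx h).elim⟩
  choose Y hY using hex
  refine Set.ncard_le_ncard_of_injOn Y (fun x hx => (hY x hx).1) ?_ (finite_brokenInitial S')
  intro x hx x' hx' hxx'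
  obtain ⟨-, f, q, j, b, r, hl, hj, ht, ht', hb, hr, hyl⟩ := hY x hx
  obtain ⟨-, f', q', j', b', r', hl', hj', hu, hu', hb', hr', hyl'⟩ := hY x' hx'
  rw [← hxx'] at hyl'
  by_cases h1 : f < f' ∨ f = f' ∧ j < j'
  · exact (hS.not_linked_of_breaksUncreated hj hj'.le h1 hb hb' ht' hr hr'
      (hyl.linked_of_le hyl' (by omega))).elim
  by_cases h2 : f' < f ∨ f' = f ∧ j' < j
  · exact (hS.not_linked_of_breaksUncreated hj' hj.le h2 hb' hb hu' hr' hr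
      (hyl'.linked_of_le hyl (by omega))).elim
  obtain rfl : f = f' := by omega
  obtain rfl : j = j' := by omega
  -- Equal charges thus come from one and the same move, and a move breaks only one good pair.
  obtain ⟨c, p₀, hp₀⟩ := h.exists_breaks hl.good_right.lt_m hj
  obtain rfl : q = q' := (hp₀ q hl.good_right ht ht').1.trans (hp₀ q' hl'.good_right hu hu').1.symm
  obtain ⟨h3, h4⟩ := hl.root_unique hl' hx.1.isRoot hx'.1.isRoot
  exact Prod.ext h3 h4

theorem AlgorithmRun.cost_le_three_mul [Finite L] {S S' : LineOrders L} (h : I.AlgorithmRun S)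
    (h' : I.Feasible S') : I.cost S ≤ 3 * I.cost S' :=
  calc I.cost S ≤ (I.createdEnding S).ncard := h.cost_le
    _ = I.nonInitialEnding.ncard + (I.brokenInitial S).ncard := h.feasible.ncard_createdEnding
    _ ≤ I.nonInitialEnding.ncard + (I.brokenInitial S').ncard :=
      Nat.add_le_add_left (h.ncard_brokenInitial_le h') _
    _ = (I.createdEnding S').ncard := h'.ncard_createdEnding.symm
    _ ≤ 3 * I.cost S' := h'.ncard_createdEnding_le

end PathNetwork

/-! ### Histories that agree up to a given time, and their extension by one move. -/

namespace LineOrders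

variable {L : Type*}

/-- The two histories coincide up to the order `π e i`. -/
def AgreeUpTo (S S' : LineOrders L) (e i : ℕ) : Prop :=
  (∀ f < e, S.t f = S'.t f ∧ S.π f = S'.π f) ∧ ∀ j ≤ i, S.π e j = S'.π e j

theorem AgreeUpTo.symm {S S' : LineOrders L} {e i : ℕ} (h : AgreeUpTo S S' e i) :
    AgreeUpTo S' S e i :=
  ⟨fun f hf => ⟨(h.1 f hf).1.symm, (h.1 f hf).2.symm⟩, fun j hj => (h.2 j hj).symm⟩

theorem AgreeUpTo.mono {S S' : LineOrders L} {e i j : ℕ} (h : AgreeUpTo S S' e i) (hj : j ≤ i) :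
    AgreeUpTo S S' e j := ⟨h.1, fun k hk => h.2 k (hk.trans hj)⟩

theorem AgreeUpTo.of_lt {S S' : LineOrders L} {e f i j : ℕ} (h : AgreeUpTo S S' e i)
    (hf : f < e) : AgreeUpTo S S' f j :=
  ⟨fun g hg => h.1 g (hg.trans hf), fun k _ => by rw [(h.1 f hf).2]⟩

/-- The history `S`, extended by the order `π` on the edge `e`. -/
def append (S : LineOrders L) (e : ℕ) (π : List L) : LineOrders L where
  t := Function.update S.t e (S.t e + 1)
  π f j := if f = e ∧ j = S.t e + 1 then π else S.π f j

theorem agreeUpTo_append (S : LineOrders L) (e : ℕ) (π : List L) :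
    AgreeUpTo S (S.append e π) e (S.t e) := by
  refine ⟨fun f hf => ⟨?_, ?_⟩, fun j hj => ?_⟩
  · simp [append, hf.ne]
  · funext j; simp [append, hf.ne]
  · have : j ≠ S.t e + 1 := by omega
    simp [append, this]

@[simp] theorem append_t (S : LineOrders L) (e : ℕ) (π : List L) :
    (S.append e π).t e = S.t e + 1 := by simp [append]

@[simp] theorem append_π (S : LineOrders L) (e : ℕ) (π : List L) :
    (S.append e π).π e (S.t e + 1) = π := by simp [append]

@[simp] theorem append_π_t (S : LineOrders L) (e : ℕ) (π : List L) :
    (S.append e π).π e (S.t e) = S.π e (S.t e) := by simp [append]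

end LineOrders

namespace PathNetwork

open ELine

variable {L : Type*} [DecidableEq L] {I : PathNetwork L}

/-! ### Existence of a run -/

theorem isChain_reds {e : ℕ} (he : e < I.m) : (I.reds e).IsChain fun x y => I.GoodPair e (x, y) :=
  List.isChain_iff_pair_infix.2 fun _ _ h => goodPair_of_infix_reds he h

theorem isChain_greens {e : ℕ} (he : e < I.m) :
    (I.greens e).IsChain fun x y => I.GoodPair e (x, y) :=
  List.isChain_iff_pair_infix.2 fun _ _ h => goodPair_of_infix_greens he h

theorem top_mem_reds (e : ℕ) : top ∈ I.reds e := by simp [reds]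

theorem bot_mem_greens (e : ℕ) : bot ∈ I.greens e := by simp [greens]

/-- Two chains of good pairs from `x` are comparable, and the one with a green line is no part of
the red list. So a good sequence that leaves the red lines has first run through all those following
`x`. -/
theorem prefix_of_red_chain {e : ℕ} (he : e < I.m) {x : ELine L} {b T : List (ELine L)}
    (hb : I.GoodSequence e (x :: b)) (hT : x :: T <:+: I.reds e) (hg : ∃ y ∈ x :: b, y ∈ I.greens e) :
    x :: T <+: x :: b := by
  rcases List.IsChain.prefix_or_prefix (fun x y z (h : I.GoodPair e (x, y)) h' =>
    h.right_unique h') hb ((isChain_reds he).infix hT) with h | h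
  · obtain ⟨y, hy, hy'⟩ := hg
    exact (not_red_of_green hy' (hT.subset (h.subset hy))).elim
  · exact h

theorem suffix_of_green_chain {e : ℕ} (he : e < I.m) {x : ELine L} {b T : List (ELine L)}
    (hb : I.GoodSequence e (b ++ [x])) (hT : T ++ [x] <:+: I.greens e)
    (hr : ∃ y ∈ b ++ [x], y ∈ I.reds e) : T ++ [x] <:+ b ++ [x] := by
  rcases List.IsChain.suffix_or_suffix (fun x y z (h : I.GoodPair e (x, z)) h' =>
    h.left_unique h') hb ((isChain_greens he).infix hT) with h | h
  · obtain ⟨y, hy, hy'⟩ := hr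
    exact (not_green_of_red hy' (hT.subset (h.subset hy))).elim
  · exact h

/-- If the block reached `bot`, consider a line `z` skipped above it. A red `z` comes after `r` in
the red list and would belong to the block; a green `z` would belong to it, being linked to `bot`; a
black `z` would force the sequence to be broken. -/
theorem downBlock_not_reaching_bottom {e : ℕ} (he : e < I.m) {π : List L} (ho : I.IsOrder e π)
    {s M b : List (ELine L)} {r : L} (hs : s ++ [line r] <+: I.reds e) (hM : M ≠ [])
    (hb : I.GoodSequence e (line r :: b)) (hm : ¬ I.MustBreak e (line r :: b)) :
    ext π ≠ s ++ M ++ line r :: b := by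
  intro h
  have hnd := ho.nodup_ext
  obtain ⟨z, M, rfl⟩ := List.exists_cons_of_ne_nil hM
  have hz : z ∈ ext π := by rw [h]; simp
  have hr : line r ∈ I.reds e := hs.subset (by simp)
  have hlast : (line r :: b).getLast? = some bot := by
    have := congrArg List.getLast? h
    rw [List.getLast?_append_of_ne_nil _ (by simp)] at this
    rw [← this]; simp [ext, List.getLast?_cons]
  have hbot := List.mem_of_getLast? hlast
  obtain ⟨b', hb'⟩ := List.getLast?_eq_some_iff.1 hlast
  rw [h, List.nodup_append] at hnd
  have hzb : z ∉ line r :: b := fun h => hnd.2.2 z (by simp) z h rfl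
  have hzs : z ∉ s := fun h => (List.nodup_append.1 hnd.1).2.2 z h z (by simp) rfl
  rcases ho.mem_ext.1 hz with hz | hz | hz
  · obtain ⟨T, hT⟩ := hs
    have hp : line r :: T <+: line r :: b :=
      prefix_of_red_chain he hb ⟨s, [], by rw [← hT]; simp⟩ ⟨bot, hbot, bot_mem_greens e⟩
    rw [← hT, List.append_assoc] at hz
    exact hzb (hp.subset ((List.mem_append.1 hz).resolve_left hzs))
  · exact hm ⟨⟨_, by simp, hr⟩, ⟨_, hbot, bot_mem_greens e⟩, z, hz, hzb⟩
  · rw [hb'] at hb hzb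
    have := suffix_of_green_chain (T := (I.endsBelow (e + 1)).map line) he hb (List.infix_refl _)
      ⟨line r, by rw [← hb']; simp, hr⟩
    exact hzb (this.subset hz)

theorem upBlock_not_reaching_top {e : ℕ} (he : e < I.m) {π : List L} (ho : I.IsOrder e π)
    {s M b : List (ELine L)} {g : L} (hs : line g :: s <:+ I.greens e) (hM : M ≠ [])
    (hb : I.GoodSequence e (b ++ [line g])) (hm : ¬ I.MustBreak e (b ++ [line g])) :
    ext π ≠ b ++ [line g] ++ (M ++ s) := by
  intro h
  have hnd := ho.nodup_ext
  obtain ⟨z, M, rfl⟩ := List.exists_cons_of_ne_nil hM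
  have hz : z ∈ ext π := by rw [h]; simp
  have hg : line g ∈ I.greens e := hs.subset (by simp)
  have hhead : (b ++ [line g]).head? = some top := by
    have := congrArg List.head? h
    rw [List.head?_append_of_ne_nil _ (by simp)] at this
    rw [← this]; simp [ext]
  have htop := List.mem_of_head? hhead
  obtain ⟨b', hb'⟩ := List.head?_eq_some_iff.1 hhead
  rw [h, List.nodup_append] at hnd
  have hzb : z ∉ b ++ [line g] := fun h => hnd.2.2 z h z (by simp) rfl
  have hzs : z ∉ s := fun h => (List.nodup_append.1 hnd.2.1).2.2 z (by simp) z h rfl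
  rcases ho.mem_ext.1 hz with hz | hz | hz
  · rw [hb'] at hb hzb
    have := prefix_of_red_chain (T := (I.endsAbove (e + 1)).map line) he hb (List.infix_refl _)
      ⟨line g, by rw [← hb']; simp, hg⟩
    exact hzb (this.subset hz)
  · exact hm ⟨⟨_, htop, top_mem_reds e⟩, ⟨_, by simp, hg⟩, z, hz, hzb⟩
  · obtain ⟨T, hT⟩ := hs
    have hp : T ++ [line g] <:+ b ++ [line g] :=
      suffix_of_green_chain he hb ⟨[], s, by rw [← hT]; simp⟩ ⟨top, htop, top_mem_reds e⟩
    have e1 : I.greens e = (T ++ [line g]) ++ s := by rw [← hT]; simp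
    rw [e1] at hz
    exact hzb (hp.subset ((List.mem_append.1 hz).resolve_right hzs))

theorem MustBreak.exists_blackPair {e : ℕ} {b : List (ELine L)} (hm : I.MustBreak e b)
    (hb : I.GoodSequence e b) : ∃ p, I.BlackPair e b p := by
  obtain ⟨hr, ⟨w, hw, hw'⟩, z, hz, -⟩ := hm
  obtain ⟨u, x, y, v, rfl, hx, hy⟩ := List.IsChain.exists_split (P := fun x => x ∈ I.reds e)
    (fun x y (h : I.GoodPair e (x, y)) hy => h.fst_red hy) hb hr ⟨w, hw, not_red_of_green hw'⟩
  have hxy : I.GoodPair e (x, y) := List.IsChain.rel_of_pair_infix hb ⟨u, v, by simp⟩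
  exact ⟨(x, y), ⟨u, v, by simp⟩, Or.inr (hxy.black_snd hz.lt_m hx hy).1⟩

theorem MustBreak.exists_breakAt {e : ℕ} {b : List (ELine L)} (hm : I.MustBreak e b)
    (hb : I.GoodSequence e b) (S : LineOrders L) (i : ℕ) : ∃ p, I.BreakAt S e i b p := by
  by_cases hc : ∃ q, I.BlackPair e b q ∧ I.Created S e i q
  · obtain ⟨q, h, h'⟩ := hc
    exact ⟨q, h, Or.inl h'⟩
  push Not at hc
  -- The edges on which some candidate pair still exists. They are bounded by `I.m`, and a pair that
  -- reaches the largest one exists on all edges from `e` up to it.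
  let N : Set ℕ := {f | ∃ q, I.BlackPair e b q ∧ I.ExistsUntil e q f}
  have hN : N.Nonempty := by
    obtain ⟨p, hp⟩ := hm.exists_blackPair hb
    exact ⟨e, p, hp, p, .refl (List.IsChain.rel_of_pair_infix hb hp.1)⟩
  have hN' : BddAbove N := ⟨I.m, by
    rintro f ⟨q, -, r, h⟩
    exact h.good_right.lt_m.le⟩
  obtain ⟨p, hp, r, hr⟩ := Nat.sSup_mem hN hN'
  refine ⟨p, hp, Or.inr ⟨hc, ?_⟩⟩
  rintro q hq f ⟨s, hs⟩
  obtain ⟨w, hw, -⟩ := hr.split hs.le (le_csSup hN' ⟨q, hq, s, hs⟩)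
  exact ⟨w, hw⟩

/-- Decisions of the algorithm depend only on the past, so earlier moves stay valid when the history
is extended. This allows a run to be built move by move. -/
theorem Created.congr {S S' : LineOrders L} {e i : ℕ} {p : ELine L × ELine L}
    (h : S.AgreeUpTo S' e i) (hc : I.Created S e i p) : I.Created S' e i p := by
  obtain ⟨f, q, j, hl, hj, hc, hc'⟩ := hc
  refine ⟨f, q, j, hl, ?_⟩
  rcases hj with ⟨hf, hj⟩ | ⟨rfl, hj⟩
  · rw [← (h.1 f hf).1, ← (h.1 f hf).2]
    exact ⟨Or.inl ⟨hf, hj⟩, hc, hc'⟩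
  · rw [← h.2 j hj.le, ← h.2 (j + 1) hj]
    exact ⟨Or.inr ⟨rfl, hj⟩, hc, hc'⟩

theorem BreakAt.congr {S S' : LineOrders L} {e i : ℕ} {b : List (ELine L)} {p : ELine L × ELine L}
    (h : S.AgreeUpTo S' e i) (hb : I.BreakAt S e i b p) : I.BreakAt S' e i b p :=
  ⟨hb.1, hb.2.imp (fun hc => hc.congr h)
    fun hc => ⟨fun q hq hq' => hc.1 q hq (hq'.congr h.symm), hc.2⟩⟩

theorem RedMove.congr {S S' : LineOrders L} {e i : ℕ} (h : S.AgreeUpTo S' e (i + 1))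
    (hm : I.RedMove S e i) : I.RedMove S' e i := by
  obtain ⟨s, r, b, moved, h1, h2, h3, M, R, h4, h5⟩ := hm
  rw [h.2 i (Nat.le_succ i)] at h1 h2 h4
  rw [h.2 (i + 1) le_rfl] at h5
  refine ⟨s, r, b, moved, h1, h2, h3.imp id ?_, M, R, h4, h5⟩
  rintro ⟨hb, B, C, x, y, hB, hbr, hmv⟩
  exact ⟨hb, B, C, x, y, hB, hbr.congr (h.mono (Nat.le_succ i)), hmv⟩

theorem GreenMove.congr {S S' : LineOrders L} {e i : ℕ} (h : S.AgreeUpTo S' e (i + 1))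
    (hm : I.GreenMove S e i) : I.GreenMove S' e i := by
  obtain ⟨h0, g, s, b, moved, h1, h2, h3, R, M, h4, h5⟩ := hm
  rw [h.2 i (Nat.le_succ i)] at h0 h1 h2 h4
  rw [h.2 (i + 1) le_rfl] at h5
  refine ⟨h0, g, s, b, moved, h1, h2, h3.imp id ?_, R, M, h4, h5⟩
  rintro ⟨hb, B, C, x, y, hB, hbr, hmv⟩
  exact ⟨hb, B, C, x, y, hB, hbr.congr (h.mono (Nat.le_succ i)), hmv⟩

theorem leftOrder_congr {S S' : LineOrders L} {e : ℕ}
    (h : ∀ f < e, S.t f = S'.t f ∧ S.π f = S'.π f) : I.leftOrder S e = I.leftOrder S' e := by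
  unfold leftOrder
  split_ifs with he
  · rw [(h (e - 1) (by omega)).1, (h (e - 1) (by omega)).2]
  · rfl

theorem RunOn.congr {S S' : LineOrders L} {e n : ℕ} (h : S.AgreeUpTo S' e n)
    (hr : I.RunOn S e n) : I.RunOn S' e n := by
  refine ⟨?_, fun i hi => ?_⟩
  · rw [← h.2 0 (Nat.zero_le n), hr.1, leftOrder_congr h.1]
  · exact (hr.2 i hi).imp (fun hm => hm.congr (h.mono hi)) (fun hm => hm.congr (h.mono hi))

theorem exists_redMove {S : LineOrders L} {e : ℕ} (he : e < I.m)
    (ho : I.IsOrder e (S.π e (S.t e))) {s : List (ELine L)} {r : L}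
    (h : I.NextRed e (S.π e (S.t e)) s r) :
    ∃ π, I.RedMove (S.append e π) e (S.t e) ∧ s ++ [line r] <+: ext π := by
  obtain ⟨h1, h2, h3⟩ := h
  have hs : s ≠ [] := by
    rintro rfl
    simp [reds] at h1
  obtain ⟨A, T, hT⟩ := List.append_of_mem (ho.mem_ext.2 (Or.inl (h1.subset (by simp))) :
    line r ∈ ext (S.π e (S.t e)))
  obtain ⟨b, C, hbC, hbr, hgs, hmax⟩ :=
    List.exists_maximal_chain_prefix (fun x y => I.GoodPair e (x, y)) (line r) T
  -- The placed lines `s` do not contain `r`, hence they lie entirely above it.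
  obtain ⟨M, rfl⟩ : s <+: A := by
    rw [hT] at h2
    rcases List.prefix_or_prefix_of_prefix h2 (List.prefix_append A _) with h | ⟨w, rfl⟩
    · exact h
    · rcases w with _ | ⟨a, w⟩
      · simp
      · have := (List.prefix_append_right_inj A).1 h2
        simp at this
        obtain ⟨rfl, -⟩ := this
        have hnd := (I.nodup_reds e).sublist h1.sublist
        simp [List.nodup_append] at hnd
  have hext : ext (S.π e (S.t e)) = s ++ M ++ b ++ C := by rw [hT, hbC, List.append_assoc _ b]
  obtain ⟨b, rfl⟩ := List.head?_eq_some_iff.1 hbr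
  have hM : M ≠ [] := by
    rintro rfl
    exact h3 ⟨b ++ C, by rw [hext]; simp⟩
  have hdown : I.DownBlock e (S.π e (S.t e)) r (line r :: b) := ⟨s ++ M, C, hext, hbr, hgs, hmax⟩
  -- Common to the unbroken and the broken case: a nonempty `R` keeps `bot` out of the moved block,
  -- so the exchange comes from an order of lines of the instance.
  have finish : ∀ mv R, ext (S.π e (S.t e)) = s ++ M ++ line r :: mv ++ R → R ≠ [] →
      (¬ I.MustBreak e (line r :: b) ∧ line r :: mv = line r :: b ∨
        I.MustBreak e (line r :: b) ∧ ∃ B C x y, line r :: b = B ++ x :: y :: C ∧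
          I.BreakAt S e (S.t e) (line r :: b) (x, y) ∧ line r :: mv = B ++ [x]) →
      ∃ π, I.RedMove (S.append e π) e (S.t e) ∧ s ++ [line r] <+: ext π := by
    intro mv R hR hRne hcase
    obtain ⟨a₁, a₂, a₃, a₄, -, rfl, rfl, h₃, rfl⟩ := ext_eq_append₄ hR hs hRne
    refine ⟨a₁ ++ a₃ ++ a₂ ++ a₄, ⟨_, r, line r :: b, line r :: mv, ⟨h1, ?_, ?_⟩, ?_, ?_, a₂.map line,
      a₄.map line ++ [bot], ?_, ?_⟩, ?_⟩
    · simpa using h2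
    · simpa using h3
    · simpa using hdown
    · refine hcase.imp id ?_
      rintro ⟨hb, B, C, x, y, hB, hbr, hmv⟩
      exact ⟨hb, B, C, x, y, hB, hbr.congr (LineOrders.agreeUpTo_append _ _ _), hmv⟩
    · rw [LineOrders.append_π_t]; exact hR
    · rw [LineOrders.append_π, ext_append₄, h₃]
    · rw [ext_append₄, ← h₃]
      exact ⟨mv ++ a₂.map line ++ (a₄.map line ++ [bot]), by simp⟩
  by_cases hm : I.MustBreak e (line r :: b)
  · obtain ⟨⟨x, y⟩, hp⟩ := hm.exists_breakAt hgs S (S.t e)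
    obtain ⟨B, C', hB⟩ := List.pair_infix_iff.1 hp.1.1
    obtain ⟨mv, hmv⟩ : ∃ mv, line r :: mv = B ++ [x] := by
      cases B with
      | nil => exact ⟨[], by simp at hB; simp [hB.1]⟩
      | cons c B => exact ⟨B ++ [x], by simp at hB; simp [hB.1]⟩
    refine finish mv (y :: C' ++ C) ?_ (by simp) (Or.inr ⟨hm, B, C', x, y, hB, hp, hmv⟩)
    rw [hext, hB, hmv]; simp
  · refine finish b C hext ?_ (Or.inl ⟨hm, rfl⟩)
    rintro rfl
    exact downBlock_not_reaching_bottom he ho h1 hM hgs hm (by rw [hext, List.append_nil])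

theorem exists_greenMove {S : LineOrders L} {e : ℕ} (he : e < I.m)
    (ho : I.IsOrder e (S.π e (S.t e))) (hr : I.reds e <+: ext (S.π e (S.t e)))
    {s : List (ELine L)} {g : L} (h : I.NextGreen e (S.π e (S.t e)) g s) :
    ∃ π, I.GreenMove (S.append e π) e (S.t e) ∧ line g :: s <:+ ext π := by
  obtain ⟨h1, h2, h3⟩ := h
  have hs : s ≠ [] := by
    rintro rfl
    obtain ⟨w, hw⟩ := h1
    have := congrArg List.getLast? hw
    simp [greens] at this
  obtain ⟨T, C, hT⟩ := List.append_of_mem (ho.mem_ext.2 (Or.inr (Or.inr (h1.subset (by simp)))) :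
    line g ∈ ext (S.π e (S.t e)))
  obtain ⟨A, b, hbA, hbg, hgs, hmax⟩ :=
    List.exists_maximal_chain_suffix (fun x y => I.GoodPair e (x, y)) (line g) T
  obtain ⟨M, rfl⟩ : s <:+ C := by
    have hC : C <:+ ext (S.π e (S.t e)) := ⟨T ++ [line g], by rw [hT]; simp⟩
    have hgC : line g :: C <:+ ext (S.π e (S.t e)) := ⟨T, by rw [hT]⟩
    rcases List.suffix_or_suffix_of_suffix h2 hgC with h | h
    · rcases List.suffix_cons_iff.1 h with rfl | h
      · have hnd := (I.nodup_greens e).sublist h1.sublist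
        simp at hnd
      · exact h
    · have hnd := (I.nodup_greens e).sublist h1.sublist
      exact ((List.nodup_cons.1 hnd).1 (h.subset (by simp))).elim
  have hext : ext (S.π e (S.t e)) = A ++ b ++ M ++ s := by
    rw [hT, ← hbA]; simp
  obtain ⟨b, rfl⟩ := List.getLast?_eq_some_iff.1 hbg
  have hM : M ≠ [] := by
    rintro rfl
    exact h3 ⟨A ++ b, by rw [hext]; simp⟩
  have hup : I.UpBlock e (S.π e (S.t e)) g (b ++ [line g]) :=
    ⟨A, M ++ s, by rw [hext]; simp, hbg, hgs, hmax⟩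
  have finish : ∀ mv R, ext (S.π e (S.t e)) = R ++ (mv ++ [line g]) ++ M ++ s → R ≠ [] →
      (¬ I.MustBreak e (b ++ [line g]) ∧ mv ++ [line g] = b ++ [line g] ∨
        I.MustBreak e (b ++ [line g]) ∧ ∃ B C x y, b ++ [line g] = B ++ x :: y :: C ∧
          I.BreakAt S e (S.t e) (b ++ [line g]) (x, y) ∧ mv ++ [line g] = y :: C) →
      ∃ π, I.GreenMove (S.append e π) e (S.t e) ∧ line g :: s <:+ ext π := by
    intro mv R hR hRne hcase
    obtain ⟨a₁, a₂, a₃, a₄, -, rfl, h₂, rfl, rfl⟩ := ext_eq_append₄ hR hRne hs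
    refine ⟨a₁ ++ a₃ ++ a₂ ++ a₄, ⟨?_, g, _, b ++ [line g], mv ++ [line g], ⟨h1, ?_, ?_⟩, ?_, ?_,
      top :: a₁.map line, a₃.map line, ?_, ?_⟩, ?_⟩
    · simpa using hr
    · simpa using h2
    · simpa using h3
    · simpa using hup
    · refine hcase.imp id ?_
      rintro ⟨hb, B, C, x, y, hB, hbr, hmv⟩
      exact ⟨hb, B, C, x, y, hB, hbr.congr (LineOrders.agreeUpTo_append _ _ _), hmv⟩
    · rw [LineOrders.append_π_t]; exact hR
    · rw [LineOrders.append_π, ext_append₄, h₂]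
    · rw [ext_append₄, ← h₂]
      exact ⟨top :: a₁.map line ++ a₃.map line ++ mv, by simp⟩
  by_cases hm : I.MustBreak e (b ++ [line g])
  · obtain ⟨⟨x, y⟩, hp⟩ := hm.exists_breakAt hgs S (S.t e)
    obtain ⟨B, C', hB⟩ := List.pair_infix_iff.1 hp.1.1
    obtain ⟨mv, hmv⟩ : ∃ mv, mv ++ [line g] = y :: C' := by
      have := congrArg List.getLast? hB
      rw [hbg, List.getLast?_append_of_ne_nil _ (by simp)] at this
      simp only [List.getLast?_cons_cons] at this
      obtain ⟨mv, hmv⟩ := List.getLast?_eq_some_iff.1 this.symm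
      exact ⟨mv, hmv.symm⟩
    refine finish mv (A ++ B ++ [x]) ?_ (by simp) (Or.inr ⟨hm, B, C', x, y, hB, hp, hmv⟩)
    rw [hext, hB, hmv]; simp
  · refine finish b A hext ?_ (Or.inl ⟨hm, rfl⟩)
    rintro rfl
    exact upBlock_not_reaching_top he ho h1 hM hgs hm (by rw [hext]; simp)

/-- The edges before `e` are completely processed. -/
def RunBefore (I : PathNetwork L) (S : LineOrders L) (e : ℕ) : Prop :=
  ∀ f < e, I.RunOn S f (S.t f) ∧
    I.reds f <+: ext (S.π f (S.t f)) ∧ I.greens f <:+ ext (S.π f (S.t f))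

theorem RunBefore.congr {S S' : LineOrders L} {e i : ℕ} (h : S.AgreeUpTo S' e i)
    (hr : I.RunBefore S e) : I.RunBefore S' e := by
  intro f hf
  obtain ⟨h1, h2, h3⟩ := hr f hf
  rw [← (h.1 f hf).1, ← (h.1 f hf).2]
  exact ⟨h1.congr (h.of_lt hf), h2, h3⟩

theorem RunOn.append {S : LineOrders L} {e : ℕ} (hr : I.RunOn S e (S.t e)) {π : List L}
    (hm : I.RedMove (S.append e π) e (S.t e) ∨ I.GreenMove (S.append e π) e (S.t e)) :
    I.RunOn (S.append e π) e ((S.append e π).t e) := by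
  have h := hr.congr (S.agreeUpTo_append e π)
  refine ⟨h.1, fun i hi => ?_⟩
  rw [LineOrders.append_t] at hi
  rcases (Nat.lt_succ_iff.1 hi).lt_or_eq with hi | rfl
  · exact h.2 i hi
  · exact hm

theorem exists_run_reds {S : LineOrders L} {e : ℕ} (he : e < I.m) (hb : I.RunBefore S e)
    (hr : I.RunOn S e (S.t e)) (s : List (ELine L)) (hs : s <+: I.reds e) :
    ∃ S', I.RunBefore S' e ∧ I.RunOn S' e (S'.t e) ∧ s <+: ext (S'.π e (S'.t e)) := by
  induction s using List.reverseRecOn with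
  | nil => exact ⟨S, hb, hr, List.nil_prefix⟩
  | append_singleton s x ih =>
    obtain ⟨S', hb', hr', hs'⟩ := ih ((List.prefix_append s [x]).trans hs)
    by_cases hx : s ++ [x] <+: ext (S'.π e (S'.t e))
    · exact ⟨S', hb', hr', hx⟩
    -- Only a line of the instance can require a move: `top` can occur only as the first red line
    -- and is then in place, and `bot` is not red.
    rcases x with _ | r | _
    · rcases s with _ | ⟨a, s⟩
      · exact (hx (by simp [ext])).elim
      · obtain ⟨w, hw⟩ := hs
        simp only [reds, List.cons_append, List.cons.injEq] at hw
        have : top ∈ (I.endsAbove (e + 1)).map line := by rw [← hw.2]; simp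
        simp at this
    · obtain ⟨π, hm, hπ⟩ := exists_redMove he
        (hr'.isOrder (fun f hf => (hb' f hf).1) he le_rfl) ⟨hs, hs', hx⟩
      refine ⟨S'.append e π, hb'.congr (S'.agreeUpTo_append e π), hr'.append (Or.inl hm), ?_⟩
      rwa [LineOrders.append_t, LineOrders.append_π]
    · exact (not_red_of_green (bot_mem_greens e) (hs.subset (by simp))).elim

theorem exists_run_greens {S : LineOrders L} {e : ℕ} (he : e < I.m) (hb : I.RunBefore S e)
    (hr : I.RunOn S e (S.t e)) (hreds : I.reds e <+: ext (S.π e (S.t e)))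
    (s : List (ELine L)) (hs : s <:+ I.greens e) :
    ∃ S', I.RunBefore S' e ∧ I.RunOn S' e (S'.t e) ∧ I.reds e <+: ext (S'.π e (S'.t e)) ∧
      s <:+ ext (S'.π e (S'.t e)) := by
  induction s with
  | nil => exact ⟨S, hb, hr, hreds, List.nil_suffix⟩
  | cons x s ih =>
    obtain ⟨S', hb', hr', hreds', hs'⟩ := ih ((List.suffix_cons x s).trans hs)
    by_cases hx : x :: s <:+ ext (S'.π e (S'.t e))
    · exact ⟨S', hb', hr', hreds', hx⟩
    rcases x with _ | g | _
    · exact (not_green_of_red (top_mem_reds e) (hs.subset (by simp))).elim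
    · have ho := hr'.isOrder (fun f hf => (hb' f hf).1) he le_rfl
      obtain ⟨π, hm, hπ⟩ := exists_greenMove he ho hreds' ⟨hs, hs', hx⟩
      refine ⟨S'.append e π, hb'.congr (S'.agreeUpTo_append e π), hr'.append (Or.inr hm), ?_, ?_⟩
      · obtain ⟨_, _, _, _, _, -, -, -, -, h2, -, -, hR, -⟩ := hm.spec he (by simpa using ho)
        rw [LineOrders.append_t, h2, List.append_assoc, List.append_assoc]
        exact hR.trans (List.prefix_append _ _)
      · rwa [LineOrders.append_t, LineOrders.append_π]
    · rcases List.eq_nil_or_concat' s with rfl | ⟨s, a, rfl⟩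
      · exact (hx ⟨top :: (S'.π e (S'.t e)).map line, by simp [ext]⟩).elim
      · obtain ⟨w, hw⟩ := hs
        have e1 : (w ++ bot :: s) ++ [a] = (I.endsBelow (e + 1)).map line ++ [bot] := by
          rw [← greens, ← hw]; simp
        have : bot ∈ (I.endsBelow (e + 1)).map line := by
          rw [← (List.append_inj' e1 rfl).1]; simp
        simp at this

theorem exists_runBefore (I : PathNetwork L) (e : ℕ) (he : e ≤ I.m) : ∃ S, I.RunBefore S e := by
  induction e with
  | zero => exact ⟨⟨fun _ => 0, fun _ _ => []⟩, fun f hf => by omega⟩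
  | succ e ih =>
    obtain ⟨S, hS⟩ := ih (by omega)
    -- The edge `e` is reset to the prescribed left order with no moves; earlier edges are
    -- untouched.
    let S₀ : LineOrders L := ⟨Function.update S.t e 0, Function.update S.π e fun _ => I.leftOrder S e⟩
    have hlt : ∀ f < e, S.t f = S₀.t f ∧ S.π f = S₀.π f := fun f hf => by simp [S₀, hf.ne]
    have hb : I.RunBefore S₀ e := by
      intro f hf
      obtain ⟨h1, h2, h3⟩ := hS f hf
      rw [← (hlt f hf).1, ← (hlt f hf).2]
      exact ⟨h1.congr ⟨fun g hg => hlt g (hg.trans hf), fun j _ => by rw [(hlt f hf).2]⟩, h2, h3⟩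
    have hr : I.RunOn S₀ e (S₀.t e) := by
      refine ⟨?_, fun i hi => ?_⟩
      · rw [← leftOrder_congr hlt]; simp [S₀]
      · simp [S₀] at hi
    obtain ⟨S₁, hb₁, hr₁, hs₁⟩ := exists_run_reds he hb hr _ (List.prefix_refl _)
    obtain ⟨S₂, hb₂, hr₂, hs₂, hg₂⟩ := exists_run_greens he hb₁ hr₁ hs₁ _ (List.suffix_refl _)
    refine ⟨S₂, fun f hf => ?_⟩
    rcases (Nat.lt_succ_iff.1 hf).lt_or_eq with hf | rfl
    · exact hb₂ f hf
    · exact ⟨hr₂, hs₂, hg₂⟩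

theorem exists_algorithmRun (I : PathNetwork L) : ∃ S, I.AlgorithmRun S := by
  obtain ⟨S, hS⟩ := I.exists_runBefore I.m le_rfl
  exact ⟨S, fun e he => (hS e he).1.1, fun e he => (hS e he).1.2, fun e he => (hS e he).2⟩

end PathNetwork

theorem mainTheorem4 {L : Type*} [DecidableEq L] [Finite L] (I : PathNetwork L) :
    (∃ S, I.AlgorithmRun S) ∧
    ∀ S, I.AlgorithmRun S →
      I.Feasible S ∧
      I.cost S ≤ 3 * I.opt ∧
      ∀ S', I.Feasible S' → (I.brokenInitial S).ncard ≤ (I.brokenInitial S').ncard := by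
  refine ⟨I.exists_algorithmRun, fun S hS => ⟨hS.feasible, ?_, fun S' hS' =>
    hS.ncard_brokenInitial_le hS'⟩⟩
  -- The run itself is feasible, so the set of costs is nonempty and its infimum `opt` is attained.
  obtain ⟨S', hS', hopt⟩ := Nat.sInf_mem (s := {c | ∃ S, I.Feasible S ∧ I.cost S = c})
    ⟨_, S, hS.feasible, rfl⟩
  have h := hS.cost_le_three_mul hS'
  rwa [hopt] at h
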